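/- Quasi-categories are simplicial sets with fillers for all inner horns; functors between them are simplicial maps. Let $\mathrm{qCat}_2$ be the 2-category of quasi-categories, functors, and hom-categories $h(Y^X)$, the homotopy category of the internal hom $Y^X$. For simplicial maps $f\colon B\to A$ and $g\colon C\to A$, the comma object $f\downarrow g$ is the pullback of $(\mathrm{cod},\mathrm{dom})\colon A^{\Delta^1}\to A\times A$ along $g\times f\colon C\times B\to A\times A$, with its projection $f\downarrow g\to C\times B$. For maps $p\colon E\to X$ and $q\colon F\to X$ of simplicial sets, let $\hom_X(p,q)$ be the fibre of $q^E\colon F^E\to X^E$ over the vertex $p$; a map $w\colon E\to F$ with $qw=p$ is an equivalence fibred over $X$ if there is a map $w'\colon F\to E$ with $pw'=q$ such that $w'w\cong\mathrm{id}_E$ in the homotopy category $h(\hom_X(p,p))$ and $ww'\cong\mathrm{id}_F$ in $h(\hom_X(q,q))$. Let $A$ and $B$ be quasi-categories and let $f\colon B\to A$ and $u\colon A\to B$ be functors. If $f$ is left adjoint to $u$ in the 2-category $\mathrm{qCat}_2$, that is, if there are 2-cells $\eta\colon \mathrm{id}_B\Rightarrow uf$ and $\epsilon\colon fu\Rightarrow\mathrm{id}_A$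 satisfying the triangle identities, then there is an equivalence, fibred over $A\times B$, between the comma objects $f\downarrow \mathrm{id}_A\to A\times B$ and $\mathrm{id}_B\downarrow u\to A\times B$. Conversely, if there is such an equivalence fibred over $A\times B$, then $f$ is left adjoint to $u$ in $\mathrm{qCat}_2$. -/

import Mathlib

open CategoryTheory MonoidalCategory CartesianMonoidalCategory Limits Simplicial

noncomputable section

namespace SSet

universe v

/-- Evaluation at the `i`-th vertex, `A ^ Δ[1] ⟶ A`; for `i = 0` this is the domain and for `i = 1`
the codomain of the generic arrow. -/
def arrowEval (A : SSet.{v}) (i : Fin 2) : (ihom (Δ[1] : SSet.{v})).obj A ⟶ A :=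
  (λ_ _).inv ≫
    ((SSet.unitHomEquiv (Δ[1] : SSet.{v})).symm (stdSimplex.obj₀Equiv.symm i) ▷ _) ≫
      (ihom.ev (Δ[1] : SSet.{v})).app A

/-- The map `(cod, dom) : A ^ Δ[1] ⟶ A × A`. -/
def arrowEnds (A : SSet.{v}) : (ihom (Δ[1] : SSet.{v})).obj A ⟶ A ⊗ A :=
  lift (arrowEval A 1) (arrowEval A 0)

/-- The comma object `f ↓ g` of `f : B ⟶ A` and `g : C ⟶ A`, whose vertices are the triples
consisting of a vertex `c` of `C`, a vertex `b` of `B` and an edge `f b ⟶ g c` of `A`. -/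
def comma {A B C : SSet.{v}} (f : B ⟶ A) (g : C ⟶ A) : SSet.{v} :=
  pullback (g ⊗ₘ f) (arrowEnds A)

/-- The canonical projection `(p₁, p₀) : f ↓ g ⟶ C × B`. -/
def commaProj {A B C : SSet.{v}} (f : B ⟶ A) (g : C ⟶ A) : comma f g ⟶ C ⊗ B :=
  pullback.fst (g ⊗ₘ f) (arrowEnds A)

/-- The simplicial hom-space `hom_A(p, q)` of the slice over `A`: the fibre of
`q ^ E : F ^ E ⟶ A ^ E` over the vertex `p`. -/
def sliceHom {A E F : SSet.{v}} (p : E ⟶ A) (q : F ⟶ A) : SSet.{v} :=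
  pullback ((ihom E).map q) (MonoidalClosed.curry' p)

/-- The vertex of `hom_A(p, q)` given by a map `w : E ⟶ F` over `A`, as an object of the homotopy
category `h (hom_A(p, q))`, which is the hom-category from `p` to `q` of the `2`-category obtained
from the simplicially enriched slice over `A`. -/
def sliceHomObj {A E F : SSet.{v}} {p : E ⟶ A} {q : F ⟶ A} (w : E ⟶ F) (hw : w ≫ q = p) :
    hoFunctor.obj (sliceHom p q) :=
  (hoFunctor.obj.equiv (sliceHom p q)).symm <|
    SSet.unitHomEquiv (sliceHom p q) <|
      pullback.lift (f := (ihom E).map q) (g := MonoidalClosed.curry' p)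
        (MonoidalClosed.curry' w) (𝟙 _) (by
          rw [MonoidalClosed.curry'_ihom_map, hw, Category.id_comp])

/-- `w : E ⟶ F` is an equivalence fibred over `A` from `p : E ⟶ A` to `q : F ⟶ A`: it is a `1`-cell
`p ⟶ q` over `A` and it has an equivalence inverse `w'` in the `2`-category whose hom-categories
are the `h (hom_A(-, -))`. -/
def IsFibredEquivalence {A E F : SSet.{v}} (p : E ⟶ A) (q : F ⟶ A) (w : E ⟶ F) : Prop :=
  ∃ (hw : w ≫ q = p) (w' : F ⟶ E) (hw' : w' ≫ p = q),
    Nonempty (sliceHomObj (p := p) (q := p) (w ≫ w') (by rw [Category.assoc, hw', hw]) ≅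
      sliceHomObj (p := p) (q := p) (𝟙 E) (Category.id_comp p)) ∧
    Nonempty (sliceHomObj (p := q) (q := q) (w' ≫ w) (by rw [Category.assoc, hw, hw']) ≅
      sliceHomObj (p := q) (q := q) (𝟙 F) (Category.id_comp q))

end SSet

end

/-! Both sides of the equivalence reduce to statements about homotopies `X ⊗ Δ[1] ⟶ Y` and
2-simplices relating them (`IsHComp`), where the classical argument by transposition of arrows
applies.

In `QCat`, the internal hom `Y^X` is a quasi-category, so every 2-cell is represented by a homotopy,
and an equation between composites of 2-cells amounts to the existence of one 2-simplex. This makes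
an adjunction a pair of homotopies η, ε with two composition triangles (`nonempty_adjunction_iff`).

A map `X ⟶ f ↓ g` is a map to the base together with a homotopy in `A`. Two such maps over the same
base are isomorphic in the homotopy category of the fibred hom-space exactly when their homotopies
represent the same 2-cell (`nonempty_sliceHomObj_iso_iff`). A fibred edge gives a square with two
constant sides. Conversely, homotopies with the same class are faces of two fillers of one inner
horn, and such fillers are coherently isomorphic relative to the horn.

Given η and ε, transposition sends `φ : f b ⟶ a` to `uφ ∘ η` and `ψ : b ⟶ u a` to `ε ∘ fψ`;
naturality and the triangle identities make these mutually inverse. Given a fibred equivalence `w`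
with inverse `w'`, set `η = w(id_f)` and `ε = w'(id_u)`. Maps over the base respect composition with
arrows of the base (`isHComp_commaMap_domain`, `isHComp_commaMap_codomain`), as in the Yoneda lemma,
and this yields the triangle identities. -/

noncomputable section

namespace SSet

universe v

/-! ### Composition of edges in a quasi-category -/

section Comp

variable {Q : SSet.{v}}

/-- `c` is a composite of the edges `a` and `b`: there is a `2`-simplex with
faces `a`, `b` and `c`. -/
def IsComp (a b c : Δ[1] ⟶ Q) : Prop :=
  ∃ T : Δ[2] ⟶ Q, stdSimplex.δ 2 ≫ T = a ∧ stdSimplex.δ 0 ≫ T = b ∧ stdSimplex.δ 1 ≫ T = c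

lemma exists_isComp [Quasicategory Q] (a b : Δ[1] ⟶ Q)
    (h : stdSimplex.δ 0 ≫ a = stdSimplex.δ 1 ≫ b) : ∃ c, IsComp a b c := by
  obtain ⟨T, hT⟩ := Quasicategory.hornFilling (S := Q) (n := 2) (i := 1) (by simp)
    (by simp [Fin.lt_def]) (horn₂₁.isPushout.desc a b h)
  refine ⟨stdSimplex.δ 1 ≫ T, T, ?_, ?_, rfl⟩
  · rw [← horn.ι_ι (1 : Fin 3) 2 (by simp), Category.assoc, ← hT]
    exact horn₂₁.isPushout.inl_desc _ _ _
  · rw [← horn.ι_ι (1 : Fin 3) 0 (by simp), Category.assoc, ← hT]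
    exact horn₂₁.isPushout.inr_desc _ _ _

lemma δ_comp_δ_stdSimplex {n : ℕ} {i j : Fin (n + 2)} (h : i ≤ j) :
    (stdSimplex.{v}.δ i : Δ[n] ⟶ Δ[n + 1]) ≫ stdSimplex.δ j.succ =
      stdSimplex.δ j ≫ stdSimplex.δ i.castSucc :=
  CosimplicialObject.δ_comp_δ stdSimplex.{v} h

/-- Associativity by filling `Λ[3, 1]`: `aᵢⱼ` is the edge from vertex i to vertex j, `hₖ` the face
opposite vertex k, and the conclusion is the missing face 1. -/
lemma IsComp.fill₁ [Quasicategory Q] {a₀₁ a₁₂ a₂₃ a₀₂ a₁₃ a₀₃ : Δ[1] ⟶ Q}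
    (h₃ : IsComp a₀₁ a₁₂ a₀₂) (h₀ : IsComp a₁₂ a₂₃ a₁₃) (h₂ : IsComp a₀₁ a₁₃ a₀₃) :
    IsComp a₀₂ a₂₃ a₀₃ := by
  obtain ⟨T₃, h₃₂, h₃₀, h₃₁⟩ := h₃
  obtain ⟨T₀, h₀₂, h₀₀, h₀₁⟩ := h₀
  obtain ⟨T₂, h₂₂, h₂₀, h₂₁⟩ := h₂
  obtain ⟨φ, hφ₀, hφ₂, hφ₃⟩ := horn₃₁.exists_desc T₀ T₂ T₃ (h₀₂.trans h₃₀.symm)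
    (h₀₁.trans h₂₀.symm) (h₂₂.trans h₃₂.symm)
  obtain ⟨T, rfl⟩ := Quasicategory.hornFilling (S := Q) (n := 3) (i := 1) (by simp)
    (by simp [Fin.lt_def]) φ
  simp only [horn.ι_ι_assoc] at hφ₀ hφ₂ hφ₃
  subst hφ₀ hφ₂ hφ₃
  refine ⟨stdSimplex.δ 1 ≫ T, ?_, ?_, ?_⟩
  · rw [← h₃₁, ← Category.assoc, ← Category.assoc]
    exact congrArg (· ≫ T) (δ_comp_δ_stdSimplex (i := (1 : Fin 3)) (j := 2) (by decide)).symm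
  · rw [← h₀₀, ← Category.assoc, ← Category.assoc]
    exact congrArg (· ≫ T) (δ_comp_δ_stdSimplex (i := (0 : Fin 3)) (j := 0) (by decide))
  · rw [← h₂₁, ← Category.assoc, ← Category.assoc]
    exact congrArg (· ≫ T) (δ_comp_δ_stdSimplex (i := (1 : Fin 3)) (j := 1) (by decide)).symm

/-- The same with `Λ[3, 2]`, whose missing face is the one opposite vertex 2. -/
lemma IsComp.fill₂ [Quasicategory Q] {a₀₁ a₁₂ a₂₃ a₀₂ a₁₃ a₀₃ : Δ[1] ⟶ Q}
    (h₃ : IsComp a₀₁ a₁₂ a₀₂) (h₀ : IsComp a₁₂ a₂₃ a₁₃) (h₁ : IsComp a₀₂ a₂₃ a₀₃) :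
    IsComp a₀₁ a₁₃ a₀₃ := by
  obtain ⟨T₃, h₃₂, h₃₀, h₃₁⟩ := h₃
  obtain ⟨T₀, h₀₂, h₀₀, h₀₁⟩ := h₀
  obtain ⟨T₁, h₁₂, h₁₀, h₁₁⟩ := h₁
  obtain ⟨φ, hφ₀, hφ₁, hφ₃⟩ := horn₃₂.exists_desc T₀ T₁ T₃ (h₁₂.trans h₃₁.symm)
    (h₀₂.trans h₃₀.symm) (h₀₀.trans h₁₀.symm)
  obtain ⟨T, rfl⟩ := Quasicategory.hornFilling (S := Q) (n := 3) (i := 2) (by simp)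
    (by simp [Fin.lt_def]) φ
  simp only [horn.ι_ι_assoc] at hφ₀ hφ₁ hφ₃
  subst hφ₀ hφ₁ hφ₃
  refine ⟨stdSimplex.δ 2 ≫ T, ?_, ?_, ?_⟩
  · rw [← h₃₂, ← Category.assoc, ← Category.assoc]
    exact congrArg (· ≫ T) (δ_comp_δ_stdSimplex (i := (2 : Fin 3)) (j := 2) (by decide)).symm
  · rw [← h₀₁, ← Category.assoc, ← Category.assoc]
    exact congrArg (· ≫ T) (δ_comp_δ_stdSimplex (i := (0 : Fin 3)) (j := 1) (by decide))
  · rw [← h₁₁, ← Category.assoc, ← Category.assoc]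
    exact congrArg (· ≫ T) (δ_comp_δ_stdSimplex (i := (1 : Fin 3)) (j := 1) (by decide))

end Comp

/-! ### The homotopy category of a quasi-category -/

section HomotopyCategory

variable {Q : SSet.{v}}

lemma δ_comp_yonedaEquiv_symm {n : ℕ} (i : Fin (n + 2)) (x : Q _⦋n + 1⦌) :
    stdSimplex.δ i ≫ yonedaEquiv.symm x = yonedaEquiv.symm (Q.δ i x) :=
  yonedaEquiv_symm_naturality_left _ _

lemma nonempty_compStruct_iff_isComp {x₀ x₁ x₂ : ((truncation 2).obj Q).obj (.op ⟨⦋0⦌, by simp⟩)}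
    (e₀₁ : Truncated.Edge x₀ x₁) (e₁₂ : Truncated.Edge x₁ x₂) (e₀₂ : Truncated.Edge x₀ x₂) :
    Nonempty (Truncated.Edge.CompStruct e₀₁ e₁₂ e₀₂) ↔
      IsComp (Q := Q) (yonedaEquiv.symm (show Q _⦋1⦌ from e₀₁.edge))
        (yonedaEquiv.symm (show Q _⦋1⦌ from e₁₂.edge))
        (yonedaEquiv.symm (show Q _⦋1⦌ from e₀₂.edge)) := by
  constructor
  · rintro ⟨s⟩
    refine ⟨yonedaEquiv.symm (show Q _⦋2⦌ from s.simplex), ?_, ?_, ?_⟩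
    · rw [δ_comp_yonedaEquiv_symm]; exact congrArg yonedaEquiv.symm s.d₂
    · rw [δ_comp_yonedaEquiv_symm]; exact congrArg yonedaEquiv.symm s.d₀
    · rw [δ_comp_yonedaEquiv_symm]; exact congrArg yonedaEquiv.symm s.d₁
  · rintro ⟨T, h₂, h₀, h₁⟩
    obtain ⟨s, rfl⟩ := yonedaEquiv.symm.surjective T
    rw [δ_comp_yonedaEquiv_symm] at h₀ h₁ h₂
    exact ⟨⟨s, yonedaEquiv.symm.injective h₂, yonedaEquiv.symm.injective h₀,
      yonedaEquiv.symm.injective h₁⟩⟩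

/-- Makes the model of the homotopy category by homotopy classes of edges available; its axioms are
fillers of `Λ[2, 1]`, `Λ[3, 1]` and `Λ[3, 2]`. -/
instance [Quasicategory Q] : Truncated.Quasicategory₂ ((truncation 2).obj Q) where
  fill21 {x₀ x₁ x₂} e₀₁ e₁₂ := by
    obtain ⟨c, T, h₂, h₀, h₁⟩ := exists_isComp (Q := Q)
      (yonedaEquiv.symm (show Q _⦋1⦌ from e₀₁.edge))
      (yonedaEquiv.symm (show Q _⦋1⦌ from e₁₂.edge)) (by
        rw [δ_comp_yonedaEquiv_symm, δ_comp_yonedaEquiv_symm]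
        exact congrArg yonedaEquiv.symm (e₀₁.tgt_eq.trans e₁₂.src_eq.symm))
    obtain ⟨s, rfl⟩ := yonedaEquiv.symm.surjective T
    rw [δ_comp_yonedaEquiv_symm] at h₀ h₁ h₂
    have h₂' := yonedaEquiv.symm.injective h₂
    have h₀' := yonedaEquiv.symm.injective h₀
    refine ⟨⟨⟨Q.δ 1 s, ?_, ?_⟩, ⟨s, h₂', h₀', rfl⟩⟩⟩
    · rw [← e₀₁.src_eq]
      refine Eq.trans ?_ (congrArg (Q.δ 1) h₂')
      exact (ConcreteCategory.congr_hom (Q.δ_comp_δ (i := (1 : Fin 2)) (j := 1) le_rfl) s).symm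
    · rw [← e₁₂.tgt_eq]
      refine Eq.trans ?_ (congrArg (Q.δ 0) h₀')
      exact ConcreteCategory.congr_hom (Q.δ_comp_δ (i := (0 : Fin 2)) (j := 0) le_rfl) s
  fill31 f₃ f₀ f₂ := by
    rw [nonempty_compStruct_iff_isComp]
    exact ((nonempty_compStruct_iff_isComp _ _ _).1 ⟨f₃⟩).fill₁
      ((nonempty_compStruct_iff_isComp _ _ _).1 ⟨f₀⟩)
      ((nonempty_compStruct_iff_isComp _ _ _).1 ⟨f₂⟩)
  fill32 f₃ f₀ f₁ := by
    rw [nonempty_compStruct_iff_isComp]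
    exact ((nonempty_compStruct_iff_isComp _ _ _).1 ⟨f₃⟩).fill₂
      ((nonempty_compStruct_iff_isComp _ _ _).1 ⟨f₀⟩)
      ((nonempty_compStruct_iff_isComp _ _ _).1 ⟨f₁⟩)

end HomotopyCategory

namespace Truncated

open SSet.Truncated.HomotopyCategory

variable {V : Truncated.{v} 2} [Quasicategory₂ V]

/-- The comparison functor to the homotopy category defined by homotopy classes of edges. -/
def toHomotopyCategory₂ : V.HomotopyCategory ⥤ HomotopyCategory₂ V :=
  HomotopyCategory.lift (fun x ↦ HomotopyCategory₂.mk x) (fun e ↦ HomotopyCategory₂.homMk e)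
    (fun _ ↦ rfl) (fun h ↦ h.homotopyCategory₂_fac)

lemma toHomotopyCategory₂_map_homMk {x y : V.obj (.op ⟨⦋0⦌, by simp⟩)} (e : Edge x y) :
    toHomotopyCategory₂.map (homMk e) = HomotopyCategory₂.homMk e :=
  HomotopyCategory.lift_map_homMk ..

/-- The category presented by generators and relations maps to the one of homotopy classes, where an
equality of composites is witnessed by an actual 2-simplex. -/
lemma homMk_comp_homMk_iff {x₀ x₁ x₂ : V.obj (.op ⟨⦋0⦌, by simp⟩)} (e₀₁ : Edge x₀ x₁)
    (e₁₂ : Edge x₁ x₂) (e₀₂ : Edge x₀ x₂) :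
    homMk e₀₁ ≫ homMk e₁₂ = homMk e₀₂ ↔ Nonempty (Edge.CompStruct e₀₁ e₁₂ e₀₂) := by
  refine ⟨fun h ↦ ?_, fun ⟨h⟩ ↦ homMk_comp_homMk h⟩
  have h' := congrArg toHomotopyCategory₂.map h
  rw [Functor.map_comp, toHomotopyCategory₂_map_homMk e₀₁, toHomotopyCategory₂_map_homMk e₁₂,
    toHomotopyCategory₂_map_homMk e₀₂] at h'
  exact Edge.CompStruct.nonempty_iff.2 h'

/-- Edges generate all morphisms, and horn filling makes them closed under composition. -/
lemma homMk_surjective {x y : V.obj (.op ⟨⦋0⦌, by simp⟩)} (φ : mk x ⟶ mk y) :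
    ∃ e : Edge x y, homMk e = φ := by
  let W : MorphismProperty V.HomotopyCategory := fun x y φ ↦
    ∃ e : Edge x.as.as y.as.as, homMk e = φ
  have : W.IsMultiplicative :=
    { id_mem x := ⟨Edge.id _, homMk_id _⟩
      comp_mem := by
        rintro x y z _ _ ⟨e, rfl⟩ ⟨e', rfl⟩
        obtain ⟨⟨e'', h⟩⟩ := Quasicategory₂.fill21 e e'
        exact ⟨e'', (homMk_comp_homMk h).symm⟩ }
  have hW : W = ⊤ := morphismProperty_eq_top (fun e ↦ ⟨e, rfl⟩)
  exact hW.symm.le φ (by simp)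

end Truncated

/-! ### Homotopies and their composition -/

section Homotopies

variable {X X' Y Y' : SSet.{v}}

/-- `L` is a composite of the homotopies `H` and `K`, as edges of the internal hom. -/
def IsHComp (H K L : X ⊗ Δ[1] ⟶ Y) : Prop :=
  ∃ T : X ⊗ Δ[2] ⟶ Y, X ◁ stdSimplex.δ 2 ≫ T = H ∧ X ◁ stdSimplex.δ 0 ≫ T = K ∧
    X ◁ stdSimplex.δ 1 ≫ T = L

lemma isHComp_iff_isComp_curry (H K L : X ⊗ Δ[1] ⟶ Y) :
    IsHComp H K L ↔
      IsComp (MonoidalClosed.curry H) (MonoidalClosed.curry K) (MonoidalClosed.curry L) := by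
  constructor
  · rintro ⟨T, rfl, rfl, rfl⟩
    exact ⟨MonoidalClosed.curry T, by simp only [MonoidalClosed.curry_natural_left, and_self]⟩
  · rintro ⟨T, h₂, h₀, h₁⟩
    refine ⟨MonoidalClosed.uncurry T, ?_, ?_, ?_⟩
    all_goals
      apply MonoidalClosed.curry_injective
      simpa only [MonoidalClosed.curry_natural_left, MonoidalClosed.curry_uncurry]

/-- The constant homotopy. -/
def constH (f : X ⟶ Y) : X ⊗ Δ[1] ⟶ Y := fst X Δ[1] ≫ f

@[simp]
lemma whiskerRight_constH (s : X' ⟶ X) (f : X ⟶ Y) : s ▷ Δ[1] ≫ constH f = constH (s ≫ f) := rfl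

lemma δ_zero_eq_const :
    (stdSimplex.{v}.δ 0 : Δ[0] ⟶ Δ[1]) = const (stdSimplex.obj₀Equiv.symm 1) := by
  decide

lemma δ_one_eq_const :
    (stdSimplex.{v}.δ 1 : Δ[0] ⟶ Δ[1]) = const (stdSimplex.obj₀Equiv.symm 0) := by
  decide

lemma whiskerLeft_δ_zero : X ◁ (stdSimplex.δ 0 : Δ[0] ⟶ Δ[1]) = fst X Δ[0] ≫ ι₁ := by
  rw [δ_zero_eq_const]; rfl

lemma whiskerLeft_δ_one : X ◁ (stdSimplex.δ 1 : Δ[0] ⟶ Δ[1]) = fst X Δ[0] ≫ ι₀ := by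
  rw [δ_one_eq_const]; rfl

/-- Allows cancelling the factor `Δ[0]` when the ends of a homotopy, taken by `ι₀` and `ι₁`, are
compared with faces. -/
instance : IsSplitEpi (fst X Δ[0]) := ⟨⟨⟨lift (𝟙 X) (const (stdSimplex.obj₀Equiv.symm 0)), rfl⟩⟩⟩

namespace IsHComp

variable {H K L : X ⊗ Δ[1] ⟶ Y}

lemma src_eq (h : IsHComp H K L) : ι₀ ≫ L = ι₀ ≫ H := by
  obtain ⟨T, rfl, rfl, rfl⟩ := h
  rw [← cancel_epi (fst X Δ[0]), ← Category.assoc, ← Category.assoc (fst X Δ[0]) ι₀,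
    ← whiskerLeft_δ_one, ← Category.assoc, ← Category.assoc, ← MonoidalCategory.whiskerLeft_comp,
    ← MonoidalCategory.whiskerLeft_comp]
  exact congrArg (fun t ↦ X ◁ t ≫ T)
    (δ_comp_δ_stdSimplex (i := (1 : Fin 2)) (j := 1) (by decide)).symm

lemma tgt_eq (h : IsHComp H K L) : ι₁ ≫ L = ι₁ ≫ K := by
  obtain ⟨T, rfl, rfl, rfl⟩ := h
  rw [← cancel_epi (fst X Δ[0]), ← Category.assoc, ← Category.assoc (fst X Δ[0]) ι₁,
    ← whiskerLeft_δ_zero, ← Category.assoc, ← Category.assoc, ← MonoidalCategory.whiskerLeft_comp,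
    ← MonoidalCategory.whiskerLeft_comp]
  exact congrArg (fun t ↦ X ◁ t ≫ T)
    (δ_comp_δ_stdSimplex (i := (0 : Fin 2)) (j := 0) (by decide))

lemma ends_eq (h : IsHComp H K L) : ι₁ ≫ H = ι₀ ≫ K := by
  obtain ⟨T, rfl, rfl, rfl⟩ := h
  rw [← cancel_epi (fst X Δ[0]), ← Category.assoc, ← Category.assoc (fst X Δ[0]) ι₀,
    ← whiskerLeft_δ_one, ← whiskerLeft_δ_zero, ← Category.assoc, ← Category.assoc,
    ← MonoidalCategory.whiskerLeft_comp, ← MonoidalCategory.whiskerLeft_comp]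
  exact congrArg (fun t ↦ X ◁ t ≫ T)
    (δ_comp_δ_stdSimplex (i := (0 : Fin 2)) (j := 1) (by decide))

lemma fill₁ [Quasicategory Y] {H₀₁ H₁₂ H₂₃ H₀₂ H₁₃ H₀₃ : X ⊗ Δ[1] ⟶ Y}
    (h₃ : IsHComp H₀₁ H₁₂ H₀₂) (h₀ : IsHComp H₁₂ H₂₃ H₁₃) (h₂ : IsHComp H₀₁ H₁₃ H₀₃) :
    IsHComp H₀₂ H₂₃ H₀₃ := by
  rw [isHComp_iff_isComp_curry] at *
  exact h₃.fill₁ h₀ h₂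

lemma fill₂ [Quasicategory Y] {H₀₁ H₁₂ H₂₃ H₀₂ H₁₃ H₀₃ : X ⊗ Δ[1] ⟶ Y}
    (h₃ : IsHComp H₀₁ H₁₂ H₀₂) (h₀ : IsHComp H₁₂ H₂₃ H₁₃) (h₁ : IsHComp H₀₂ H₂₃ H₀₃) :
    IsHComp H₀₁ H₁₃ H₀₃ := by
  rw [isHComp_iff_isComp_curry] at *
  exact h₃.fill₂ h₀ h₁

lemma precomp (h : IsHComp H K L) (s : X' ⟶ X) :
    IsHComp (s ▷ Δ[1] ≫ H) (s ▷ Δ[1] ≫ K) (s ▷ Δ[1] ≫ L) := by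
  obtain ⟨T, rfl, rfl, rfl⟩ := h
  exact ⟨s ▷ Δ[2] ≫ T, rfl, rfl, rfl⟩

lemma postcomp (h : IsHComp H K L) (k : Y ⟶ Y') : IsHComp (H ≫ k) (K ≫ k) (L ≫ k) := by
  obtain ⟨T, rfl, rfl, rfl⟩ := h
  exact ⟨T ≫ k, rfl, rfl, rfl⟩

end IsHComp

lemma exists_isHComp [Quasicategory Y] (H K : X ⊗ Δ[1] ⟶ Y) (h : ι₁ ≫ H = ι₀ ≫ K) :
    ∃ L, IsHComp H K L := by
  obtain ⟨c, hc⟩ := exists_isComp (MonoidalClosed.curry H) (MonoidalClosed.curry K) (by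
    rw [← MonoidalClosed.curry_natural_left, ← MonoidalClosed.curry_natural_left,
      whiskerLeft_δ_zero, whiskerLeft_δ_one, Category.assoc, Category.assoc, h])
  refine ⟨MonoidalClosed.uncurry c, ?_⟩
  rwa [isHComp_iff_isComp_curry, MonoidalClosed.curry_uncurry]

lemma δ_two_σ_zero : (stdSimplex.{v}.δ 2 : Δ[1] ⟶ Δ[2]) ≫ stdSimplex.σ 0 =
    const (stdSimplex.obj₀Equiv.symm 0) := by decide

lemma δ_zero_σ_zero : (stdSimplex.{v}.δ 0 : Δ[1] ⟶ Δ[2]) ≫ stdSimplex.σ 0 = 𝟙 _ := by decide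

lemma δ_one_σ_zero : (stdSimplex.{v}.δ 1 : Δ[1] ⟶ Δ[2]) ≫ stdSimplex.σ 0 = 𝟙 _ := by decide

lemma δ_two_σ_one : (stdSimplex.{v}.δ 2 : Δ[1] ⟶ Δ[2]) ≫ stdSimplex.σ 1 = 𝟙 _ := by decide

lemma δ_zero_σ_one : (stdSimplex.{v}.δ 0 : Δ[1] ⟶ Δ[2]) ≫ stdSimplex.σ 1 =
    const (stdSimplex.obj₀Equiv.symm 1) := by decide

lemma δ_one_σ_one : (stdSimplex.{v}.δ 1 : Δ[1] ⟶ Δ[2]) ≫ stdSimplex.σ 1 = 𝟙 _ := by decide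

lemma isHComp_const_left (H : X ⊗ Δ[1] ⟶ Y) : IsHComp (constH (ι₀ ≫ H)) H H := by
  refine ⟨X ◁ stdSimplex.σ 0 ≫ H, ?_, ?_, ?_⟩
  · rw [← MonoidalCategory.whiskerLeft_comp_assoc, δ_two_σ_zero]; rfl
  · rw [← MonoidalCategory.whiskerLeft_comp_assoc, δ_zero_σ_zero]; rfl
  · rw [← MonoidalCategory.whiskerLeft_comp_assoc, δ_one_σ_zero]; rfl

lemma isHComp_const_right (H : X ⊗ Δ[1] ⟶ Y) : IsHComp H (constH (ι₁ ≫ H)) H := by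
  refine ⟨X ◁ stdSimplex.σ 1 ≫ H, ?_, ?_, ?_⟩
  · rw [← MonoidalCategory.whiskerLeft_comp_assoc, δ_two_σ_one]; rfl
  · rw [← MonoidalCategory.whiskerLeft_comp_assoc, δ_zero_σ_one]; rfl
  · rw [← MonoidalCategory.whiskerLeft_comp_assoc, δ_one_σ_one]; rfl

lemma isHComp_const (f : X ⟶ Y) : IsHComp (constH f) (constH f) (constH f) :=
  isHComp_const_left (constH f)

/-- The two composites around a square of homotopies agree. -/
lemma exists_isHComp_square (S : (X ⊗ Δ[1]) ⊗ Δ[1] ⟶ Y) :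
    ∃ D, IsHComp (ι₀ ≫ S) (ι₁ ▷ Δ[1] ≫ S) D ∧ IsHComp (ι₀ ▷ Δ[1] ≫ S) (ι₁ ≫ S) D := by
  -- The square is two triangles glued along its diagonal: `(σ 1, σ 0)` moves the inner coordinate
  -- first, `(σ 0, σ 1)` the outer one.
  refine ⟨lift (𝟙 _) (snd X Δ[1]) ≫ S,
    ⟨lift (X ◁ stdSimplex.σ 1) (snd X Δ[2] ≫ stdSimplex.σ 0) ≫ S, ?_, ?_, ?_⟩,
    ⟨lift (X ◁ stdSimplex.σ 0) (snd X Δ[2] ≫ stdSimplex.σ 1) ≫ S, ?_, ?_, ?_⟩⟩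
  all_goals
    rw [← Category.assoc, comp_lift, ← MonoidalCategory.whiskerLeft_comp, whiskerLeft_snd_assoc]
    simp only [δ_two_σ_zero, δ_zero_σ_zero, δ_one_σ_zero, δ_two_σ_one, δ_zero_σ_one, δ_one_σ_one]
    rfl

/-- Two homotopies with the same ends represent the same `2`-cell. -/
def HEquiv (H H' : X ⊗ Δ[1] ⟶ Y) : Prop := IsHComp H (constH (ι₁ ≫ H)) H'

namespace HEquiv

lemma refl (H : X ⊗ Δ[1] ⟶ Y) : HEquiv H H := isHComp_const_right H

lemma precomp {H H' : X ⊗ Δ[1] ⟶ Y} (h : HEquiv H H') (s : X' ⟶ X) :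
    HEquiv (s ▷ Δ[1] ≫ H) (s ▷ Δ[1] ≫ H') := IsHComp.precomp h s

variable [Quasicategory Y] {H H' H'' : X ⊗ Δ[1] ⟶ Y}

lemma symm (h : HEquiv H H') : HEquiv H' H := by
  have h' := IsHComp.fill₁ h (isHComp_const _) (isHComp_const_right H)
  rwa [HEquiv, h.tgt_eq]

lemma trans (h : HEquiv H H') (h' : HEquiv H' H'') : HEquiv H H'' := by
  refine IsHComp.fill₂ (H₂₃ := constH (ι₁ ≫ H)) h (isHComp_const _) ?_
  rw [HEquiv, h.tgt_eq] at h'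
  exact h'

/-- Left and right homotopy of edges agree: fill a 3-horn whose first and last edges are constant.
-/
lemma iff_left : HEquiv H H' ↔ IsHComp (constH (ι₀ ≫ H)) H H' :=
  ⟨fun h ↦ IsHComp.fill₂ (isHComp_const_left H) (isHComp_const_right H) h,
    fun h ↦ IsHComp.fill₁ (isHComp_const_left H) (isHComp_const_right H) h⟩

end HEquiv

namespace IsHComp

variable [Quasicategory Y] {H K L L' : X ⊗ Δ[1] ⟶ Y}

lemma congr_right (h : IsHComp H K L) (hL : HEquiv L L') : IsHComp H K L' := by
  rw [HEquiv, h.tgt_eq] at hL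
  exact h.fill₂ (isHComp_const_right K) hL

end IsHComp

end Homotopies

/-! ### Fillers of an inner anodyne extension are coherently isomorphic -/

section CoherentIso

/-- The subcomplex of the coherent isomorphism consisting of its two vertices. -/
def coherentIsoEnds : coherentIso.{v}.Subcomplex where
  obj n := {s | ∀ i : Fin (n.unop.len + 1), s.obj i = s.obj 0}
  map {n m} θ s hs i := by
    exact (hs (θ.unop.toOrderHom i)).trans (hs (θ.unop.toOrderHom 0)).symm

open Classical in
/-- The map out of `V ⊗ coherentIsoEnds` given by two maps out of `V`. -/
def coherentIsoEndsDesc {V Q : SSet.{v}} (t₀ t₁ : V ⟶ Q) :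
    V ⊗ (coherentIsoEnds.{v} : SSet.{v}) ⟶ Q where
  app n := ↾fun x ↦ if x.2.1.obj 0 = WalkingIso.zero then t₀.app n x.1 else t₁.app n x.1
  naturality n m θ := by
    ext ⟨y, s, hs⟩
    have h : s.obj (θ.unop.toOrderHom 0) = s.obj 0 := hs _
    change (if s.obj (θ.unop.toOrderHom 0) = WalkingIso.zero then t₀.app m (V.map θ y) else
      t₁.app m (V.map θ y)) = Q.map θ (if s.obj 0 = WalkingIso.zero then t₀.app n y else t₁.app n y)
    rw [h]
    split_ifs
    · exact NatTrans.naturality_apply t₀ θ y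
    · exact NatTrans.naturality_apply t₁ θ y

lemma exists_extension_of_innerAnodyneExtensions {U V Q : SSet.{v}} {i : U ⟶ V}
    (hi : innerAnodyneExtensions i) [Quasicategory Q] (g : U ⟶ Q) : ∃ g' : V ⟶ Q, i ≫ g' = g := by
  have := hi _ (mem_innerFibrations (terminal.from Q))
  have sq : CommSq g i (terminal.from Q) (terminal.from V) := ⟨by simp⟩
  exact ⟨sq.lift, sq.fac_left⟩

lemma x₀_mem_coherentIsoEnds : coherentIso.x₀ ∈ coherentIsoEnds.{v}.obj (.op ⦋0⦌) :=
  fun (i : Fin 1) ↦ by rw [Subsingleton.elim i 0]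

lemma x₁_mem_coherentIsoEnds : coherentIso.x₁ ∈ coherentIsoEnds.{v}.obj (.op ⦋0⦌) :=
  fun (i : Fin 1) ↦ by rw [Subsingleton.elim i 0]

lemma lift_const_coherentIsoEnds {V : SSet.{v}} (U : V.Subcomplex) (x : coherentIso.{v} _⦋0⦌)
    (hx : x ∈ coherentIsoEnds.{v}.obj (.op ⦋0⦌)) :
    lift (𝟙 V) (const x) =
      lift (𝟙 V) (const (Y := (coherentIsoEnds.{v} : SSet.{v})) ⟨x, hx⟩) ≫
        Subcomplex.unionProd.ι₁ U coherentIsoEnds ≫ (U.unionProd coherentIsoEnds).ι := by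
  rw [Subcomplex.unionProd.ι₁_ι, lift_whiskerLeft]
  rfl

/-- The pushout-product of the inner anodyne `U ⊆ V` with the two ends of `coherentIso` is again
inner anodyne. The map to extend is `t₀`, `t₁` on the ends and constant along `coherentIso` on `U`.
-/
lemma exists_coherentIso_filler {V Q : SSet.{v}} (U : V.Subcomplex)
    (hU : innerAnodyneExtensions U.ι) [Quasicategory Q] (t₀ t₁ : V ⟶ Q) (h : U.ι ≫ t₀ = U.ι ≫ t₁) :
    ∃ M : V ⊗ coherentIso.{v} ⟶ Q, U.ι ▷ _ ≫ M = fst _ _ ≫ U.ι ≫ t₀ ∧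
      lift (𝟙 V) (const coherentIso.x₀) ≫ M = t₀ ∧
      lift (𝟙 V) (const coherentIso.x₁) ≫ M = t₁ := by
  obtain ⟨M, hM⟩ := exists_extension_of_innerAnodyneExtensions (Q := Q)
    (innerAnodyneExtensions_unionProd_ι' U coherentIsoEnds hU)
    ((Subcomplex.unionProd.isPushout U coherentIsoEnds).desc (coherentIsoEndsDesc t₀ t₁)
      (fst _ _ ≫ U.ι ≫ t₀) (by
        ext n ⟨y, s⟩
        change (if s.1.obj 0 = WalkingIso.zero then t₀.app n y.1 else t₁.app n y.1) = t₀.app n y.1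
        have h' : t₀.app n y.1 = t₁.app n y.1 :=
          ConcreteCategory.congr_hom (NatTrans.congr_app h n) y
        rw [← h', ite_self]))
  refine ⟨M, ?_, ?_, ?_⟩
  · rw [← Subcomplex.unionProd.ι₂_ι U coherentIsoEnds, Category.assoc, hM, IsPushout.inr_desc]
  · rw [lift_const_coherentIsoEnds U coherentIso.x₀ x₀_mem_coherentIsoEnds, Category.assoc,
      Category.assoc, hM, IsPushout.inl_desc]
    ext n y
    change ite ((ComposableArrows.mk₀ WalkingIso.zero.{v}).obj 0 = WalkingIso.zero)
      (t₀.app n y) (t₁.app n y) = _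
    exact if_pos rfl
  · rw [lift_const_coherentIsoEnds U coherentIso.x₁ x₁_mem_coherentIsoEnds, Category.assoc,
      Category.assoc, hM, IsPushout.inl_desc]
    ext n y
    change ite ((ComposableArrows.mk₀ WalkingIso.one.{v}).obj 0 = WalkingIso.zero)
      (t₀.app n y) (t₁.app n y) = _
    exact if_neg (by rintro ⟨⟩)

/-- Homotopies representing the same `2`-cell are coherently isomorphic relative to their ends. -/
lemma HEquiv.exists_coherentIso {X Y : SSet.{v}} [Quasicategory Y] {H H' : X ⊗ Δ[1] ⟶ Y}
    (h : HEquiv H H') :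
    ∃ K : (X ⊗ coherentIso.{v}) ⊗ Δ[1] ⟶ Y, ι₀ ≫ K = fst _ _ ≫ ι₀ ≫ H ∧
      ι₁ ≫ K = fst _ _ ≫ ι₁ ≫ H ∧ lift (𝟙 X) (const coherentIso.x₀) ▷ Δ[1] ≫ K = H ∧
      lift (𝟙 X) (const coherentIso.x₁) ▷ Δ[1] ≫ K = H' := by
  obtain ⟨T, h₂, h₀, h₁⟩ := h
  -- `T` and `T'` fill the same inner horn, formed by `H` and a constant homotopy; their remaining
  -- faces are `H'` and `H`.
  obtain ⟨T', h₂', h₀', h₁'⟩ := isHComp_const_right H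
  obtain ⟨M, hM, hM₀, hM₁⟩ := exists_coherentIso_filler Λ[2, 1]
    (innerAnodyneExtensions.horn_ι (by simp) (by simp [Fin.lt_def]))
    (MonoidalClosed.curry T') (MonoidalClosed.curry T) (by
      apply horn₂₁.isPushout.hom_ext
      · rw [horn.ι_ι_assoc, horn.ι_ι_assoc, ← MonoidalClosed.curry_natural_left,
          ← MonoidalClosed.curry_natural_left, h₂, h₂']
      · rw [horn.ι_ι_assoc, horn.ι_ι_assoc, ← MonoidalClosed.curry_natural_left,
          ← MonoidalClosed.curry_natural_left, h₀, h₀'])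
  have key {Z : SSet.{v}} (s : Z ⟶ Δ[2]) (j : Z ⟶ coherentIso.{v}) (t : X ⊗ Δ[2] ⟶ Y)
      (hs : lift s j ≫ M = s ≫ MonoidalClosed.curry t) :
      X ◁ lift s j ≫ MonoidalClosed.uncurry M = X ◁ s ≫ t := by
    rw [← MonoidalClosed.uncurry_natural_left, hs, MonoidalClosed.uncurry_natural_left,
      MonoidalClosed.uncurry_curry]
  have key' {Z : SSet.{v}} (s : Z ⟶ Λ[2, 1]) (j : Z ⟶ coherentIso.{v}) :
      X ◁ lift (s ≫ Λ[2, 1].ι) j ≫ MonoidalClosed.uncurry M = X ◁ (s ≫ Λ[2, 1].ι) ≫ T' := by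
    refine key _ _ _ ?_
    have : lift (s ≫ Λ[2, 1].ι) j = lift s j ≫ Λ[2, 1].ι ▷ coherentIso.{v} := by simp
    rw [this, Category.assoc, hM, lift_fst_assoc, Category.assoc]
  -- Restrict `M` to face 1. The two end vertices of this face lie in the horn, where `M` is
  -- constant along `coherentIso`, so the ends stay fixed.
  refine ⟨lift (fst _ _ ≫ fst _ _) (lift (snd _ _ ≫ stdSimplex.δ 1) (fst _ _ ≫ snd _ _)) ≫
    MonoidalClosed.uncurry M, ?_, ?_, ?_, ?_⟩
  · refine (key' (const (stdSimplex.obj₀Equiv.symm 0) ≫ horn₂₁.ι₀₁) (𝟙 coherentIso.{v})).trans ?_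
    rw [Category.assoc, horn.ι_ι, MonoidalCategory.whiskerLeft_comp_assoc, h₂']
    rfl
  · refine (key' (const (stdSimplex.obj₀Equiv.symm 1) ≫ horn₂₁.ι₁₂) (𝟙 coherentIso.{v})).trans ?_
    rw [Category.assoc, horn.ι_ι, MonoidalCategory.whiskerLeft_comp_assoc, h₀']
    rfl
  · rw [← h₁']
    refine key (stdSimplex.δ 1) (const coherentIso.x₀) T' ?_
    rw [← hM₀, ← Category.assoc]
    rfl
  · rw [← h₁]
    refine key (stdSimplex.δ 1) (const coherentIso.x₁) T ?_
    rw [← hM₁, ← Category.assoc]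
    rfl

end CoherentIso

/-! ### Maps into a comma object -/

section Ihom
variable {A X X' V : SSet.{v}}

/-- The homotopy parametrized by `V` which corresponds to a map into the internal hom `A ^ V`. -/
def ofIhom (K : X ⟶ (ihom V).obj A) : X ⊗ V ⟶ A := (β_ X V).hom ≫ MonoidalClosed.uncurry K

/-- The map into the internal hom `A ^ V` which corresponds to a homotopy parametrized by `V`. -/
def toIhom (H : X ⊗ V ⟶ A) : X ⟶ (ihom V).obj A := MonoidalClosed.curry ((β_ V X).hom ≫ H)

@[simp]
lemma ofIhom_toIhom (H : X ⊗ V ⟶ A) : ofIhom (toIhom H) = H := by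
  rw [ofIhom, toIhom, MonoidalClosed.uncurry_curry, SymmetricCategory.symmetry_assoc]

@[simp]
lemma toIhom_ofIhom (K : X ⟶ (ihom V).obj A) : toIhom (ofIhom K) = K := by
  rw [ofIhom, toIhom, SymmetricCategory.symmetry_assoc, MonoidalClosed.curry_uncurry]

lemma whiskerRight_ofIhom (s : X' ⟶ X) (K : X ⟶ (ihom V).obj A) :
    s ▷ V ≫ ofIhom K = ofIhom (s ≫ K) := by
  rw [ofIhom, ofIhom, BraidedCategory.braiding_naturality_left_assoc,
    MonoidalClosed.uncurry_natural_left]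

lemma arrowEval_zero (K : X ⟶ (ihom (Δ[1] : SSet.{v})).obj A) :
    K ≫ arrowEval A 0 = ι₀ ≫ ofIhom K := by
  rw [ofIhom, MonoidalClosed.uncurry_eq]
  rfl

lemma arrowEval_one (K : X ⟶ (ihom (Δ[1] : SSet.{v})).obj A) :
    K ≫ arrowEval A 1 = ι₁ ≫ ofIhom K := by
  rw [ofIhom, MonoidalClosed.uncurry_eq]
  rfl
end Ihom

section Comma

variable {A B C X X' : SSet.{v}} {f : B ⟶ A} {g : C ⟶ A}

/-- The map into the comma object `f ↓ g` induced by a homotopy `b ≫ f ⟶ c ≫ g`. -/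
def commaLift (c : X ⟶ C) (b : X ⟶ B) (H : X ⊗ Δ[1] ⟶ A) (h₀ : ι₀ ≫ H = b ≫ f)
    (h₁ : ι₁ ≫ H = c ≫ g) : X ⟶ comma f g :=
  pullback.lift (f := g ⊗ₘ f) (g := arrowEnds A) (lift c b) (toIhom H) (by
    rw [arrowEnds, comp_lift, arrowEval_zero, arrowEval_one, ofIhom_toIhom, h₀, h₁, lift_map])

@[simp]
lemma commaLift_proj (c : X ⟶ C) (b : X ⟶ B) (H : X ⊗ Δ[1] ⟶ A) (h₀ : ι₀ ≫ H = b ≫ f)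
    (h₁ : ι₁ ≫ H = c ≫ g) : commaLift c b H h₀ h₁ ≫ commaProj f g = lift c b :=
  pullback.lift_fst _ _ _

variable (f g) in
/-- The generic arrow of the comma object `f ↓ g`. -/
def commaArrow : comma f g ⟶ (ihom Δ[1]).obj A := pullback.snd (g ⊗ₘ f) (arrowEnds A)

lemma commaProj_comp_tensorHom : commaProj f g ≫ (g ⊗ₘ f) = commaArrow f g ≫ arrowEnds A :=
  pullback.condition

lemma commaLift_arrow (c : X ⟶ C) (b : X ⟶ B) (H : X ⊗ Δ[1] ⟶ A) (h₀ : ι₀ ≫ H = b ≫ f)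
    (h₁ : ι₁ ≫ H = c ≫ g) : commaLift c b H h₀ h₁ ≫ commaArrow f g = toIhom H :=
  pullback.lift_snd _ _ _

variable (f g) in
/-- The canonical homotopy on the comma object `f ↓ g`. -/
def commaHtpy : comma f g ⊗ Δ[1] ⟶ A := ofIhom (commaArrow f g)

@[simp]
lemma commaLift_htpy (c : X ⟶ C) (b : X ⟶ B) (H : X ⊗ Δ[1] ⟶ A) (h₀ : ι₀ ≫ H = b ≫ f)
    (h₁ : ι₁ ≫ H = c ≫ g) : commaLift c b H h₀ h₁ ▷ Δ[1] ≫ commaHtpy f g = H := by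
  rw [commaHtpy, whiskerRight_ofIhom, commaLift_arrow, ofIhom_toIhom]

lemma ι₀_commaHtpy : ι₀ ≫ commaHtpy f g = commaProj f g ≫ snd C B ≫ f := by
  have := congrArg (· ≫ snd A A) (commaProj_comp_tensorHom (f := f) (g := g))
  rw [commaHtpy, ← arrowEval_zero]
  simpa [arrowEnds] using this.symm

lemma ι₁_commaHtpy : ι₁ ≫ commaHtpy f g = commaProj f g ≫ fst C B ≫ g := by
  have := congrArg (· ≫ fst A A) (commaProj_comp_tensorHom (f := f) (g := g))
  rw [commaHtpy, ← arrowEval_one]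
  simpa [arrowEnds] using this.symm

lemma comma_hom_ext {w w' : X ⟶ comma f g} (h : w ≫ commaProj f g = w' ≫ commaProj f g)
    (h' : w ▷ Δ[1] ≫ commaHtpy f g = w' ▷ Δ[1] ≫ commaHtpy f g) : w = w' := by
  apply pullback.hom_ext
  · exact h
  · rw [commaHtpy, whiskerRight_ofIhom, whiskerRight_ofIhom] at h'
    exact (toIhom_ofIhom _).symm.trans ((congrArg toIhom h').trans (toIhom_ofIhom _))

/-- A homotopy of maps into a comma object which is constant on the base does not change the
represented `2`-cell. -/
lemma hEquiv_of_homotopy_over [Quasicategory A] (G : X ⊗ Δ[1] ⟶ comma f g) (z : X ⟶ C ⊗ B)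
    (hG : G ≫ commaProj f g = fst X Δ[1] ≫ z) :
    HEquiv ((ι₀ ≫ G) ▷ Δ[1] ≫ commaHtpy f g) ((ι₁ ≫ G) ▷ Δ[1] ≫ commaHtpy f g) := by
  -- Since `G` is constant on the base, two opposite sides of this square are constant, so both
  -- other sides are equivalent to the diagonal `D`.
  obtain ⟨D, h, h'⟩ := exists_isHComp_square (G ▷ Δ[1] ≫ commaHtpy f g)
  rw [ι₀_comp_assoc, ι₀_commaHtpy, reassoc_of% hG] at h
  rw [ι₁_comp_assoc, ι₁_commaHtpy, reassoc_of% hG] at h'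
  rw [← comp_whiskerRight_assoc] at h h'
  have e : ι₁ ≫ (ι₀ ≫ G) ▷ Δ[1] ≫ commaHtpy f g = z ≫ fst C B ≫ g := by
    rw [ι₁_comp_assoc, ι₁_commaHtpy, Category.assoc, reassoc_of% hG, ι₀_fst_assoc]
  have e' : ι₀ ≫ (ι₁ ≫ G) ▷ Δ[1] ≫ commaHtpy f g = z ≫ snd C B ≫ f := by
    rw [ι₀_comp_assoc, ι₀_commaHtpy, Category.assoc, reassoc_of% hG, ι₁_fst_assoc]
  have h₀ : HEquiv ((ι₀ ≫ G) ▷ Δ[1] ≫ commaHtpy f g) D := by rw [HEquiv, e]; exact h'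
  have h₁ : HEquiv ((ι₁ ≫ G) ▷ Δ[1] ≫ commaHtpy f g) D := by rw [HEquiv.iff_left, e']; exact h
  exact h₀.trans h₁.symm

/-- Maps into a comma object over the same base which represent the same `2`-cell are
coherently isomorphic over the base. -/
lemma exists_coherentIso_over [Quasicategory A] {w w' : X ⟶ comma f g}
    (hw : w ≫ commaProj f g = w' ≫ commaProj f g)
    (h : HEquiv (w ▷ Δ[1] ≫ commaHtpy f g) (w' ▷ Δ[1] ≫ commaHtpy f g)) :
    ∃ G : X ⊗ coherentIso.{v} ⟶ comma f g, G ≫ commaProj f g = fst _ _ ≫ w ≫ commaProj f g ∧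
      lift (𝟙 X) (const coherentIso.x₀) ≫ G = w ∧ lift (𝟙 X) (const coherentIso.x₁) ≫ G = w' := by
  obtain ⟨K, h₀, h₁, hK₀, hK₁⟩ := h.exists_coherentIso
  rw [ι₀_comp_assoc, ι₀_commaHtpy] at h₀
  rw [ι₁_comp_assoc, ι₁_commaHtpy] at h₁
  let G : X ⊗ coherentIso.{v} ⟶ comma f g := commaLift (fst _ _ ≫ w ≫ commaProj f g ≫ fst C B)
    (fst _ _ ≫ w ≫ commaProj f g ≫ snd C B) K (by simpa using h₀) (by simpa using h₁)
  have hG : G ≫ commaProj f g = fst _ _ ≫ w ≫ commaProj f g := by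
    rw [commaLift_proj, ← comp_lift, ← comp_lift, ← comp_lift, lift_fst_snd, Category.comp_id]
  refine ⟨G, hG, comma_hom_ext ?_ ?_, comma_hom_ext ?_ ?_⟩
  · rw [Category.assoc, hG, lift_fst_assoc, Category.id_comp]
  · rw [comp_whiskerRight_assoc, commaLift_htpy, hK₀]
  · rw [Category.assoc, hG, lift_fst_assoc, Category.id_comp, hw]
  · rw [comp_whiskerRight_assoc, commaLift_htpy, hK₁]

end Comma

/-! ### The hom-spaces of the slice -/

section SliceHom

variable {S E F V : SSet.{v}} {p : E ⟶ S} {q : F ⟶ S}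

variable (p q) in
/-- The inclusion of the hom-space of the slice into the internal hom. -/
def sliceIncl : sliceHom p q ⟶ (ihom E).obj F :=
  pullback.fst ((ihom E).map q) (MonoidalClosed.curry' p)

variable (p q) in
/-- The evaluation map of the hom-space of the slice. -/
def sliceEval : E ⊗ sliceHom p q ⟶ F := MonoidalClosed.uncurry (sliceIncl p q)

lemma toUnit_curry' (p : E ⟶ S) :
    toUnit V ≫ MonoidalClosed.curry' p = MonoidalClosed.curry (fst E V ≫ p) := by
  rw [MonoidalClosed.curry', ← MonoidalClosed.curry_natural_left]
  congr 1

variable (p q) in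
lemma sliceIncl_map : sliceIncl p q ≫ (ihom E).map q = toUnit _ ≫ MonoidalClosed.curry' p := by
  refine pullback.condition.trans (congrArg (· ≫ MonoidalClosed.curry' p) ?_)
  exact toUnit_unique _ _

variable (p q) in
lemma sliceEval_comp : sliceEval p q ≫ q = fst _ _ ≫ p := by
  apply MonoidalClosed.curry_injective
  rw [sliceEval, MonoidalClosed.curry_natural_right, MonoidalClosed.curry_uncurry, sliceIncl_map,
    toUnit_curry']

/-- The map into the hom-space of the slice given by a family of maps over the base. -/
def sliceLift (G : E ⊗ V ⟶ F) (hG : G ≫ q = fst E V ≫ p) : V ⟶ sliceHom p q :=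
  pullback.lift (f := (ihom E).map q) (g := MonoidalClosed.curry' p) (MonoidalClosed.curry G)
    (toUnit V) (by rw [toUnit_curry', ← hG, MonoidalClosed.curry_natural_right])

@[simp]
lemma sliceLift_incl (G : E ⊗ V ⟶ F) (hG : G ≫ q = fst E V ≫ p) :
    sliceLift G hG ≫ sliceIncl p q = MonoidalClosed.curry G :=
  pullback.lift_fst _ _ _

@[simp]
lemma sliceLift_eval (G : E ⊗ V ⟶ F) (hG : G ≫ q = fst E V ≫ p) :
    E ◁ sliceLift G hG ≫ sliceEval p q = G := by
  rw [sliceEval, ← MonoidalClosed.uncurry_natural_left, sliceLift_incl,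
    MonoidalClosed.uncurry_curry]

lemma slice_hom_ext {k k' : V ⟶ sliceHom p q}
    (h : E ◁ k ≫ sliceEval p q = E ◁ k' ≫ sliceEval p q) : k = k' := by
  apply pullback.hom_ext
  · rw [sliceEval, ← MonoidalClosed.uncurry_natural_left,
      ← MonoidalClosed.uncurry_natural_left] at h
    exact MonoidalClosed.uncurry_injective h
  · exact toUnit_unique _ _

/-- The vertex of the hom-space of the slice given by a map over the base. -/
def sliceVertex (w : E ⟶ F) (hw : w ≫ q = p) : (sliceHom p q) _⦋0⦌ :=
  SSet.unitHomEquiv (sliceHom p q) (sliceLift (fst E (𝟙_ SSet.{v}) ≫ w)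
    (by rw [Category.assoc, hw]))

lemma sliceHomObj_eq (w : E ⟶ F) (hw : w ≫ q = p) :
    sliceHomObj w hw = (hoFunctor.obj.equiv _).symm (sliceVertex w hw) :=
  rfl

/-- The map over the base given by a vertex of the hom-space of the slice. -/
def sliceVertexMap (x : (sliceHom p q) _⦋0⦌) : E ⟶ F := lift (𝟙 E) (const x) ≫ sliceEval p q

lemma const_unitHomEquiv {X Y : SSet.{v}} (k : 𝟙_ SSet.{v} ⟶ Y) :
    const (X := X) (SSet.unitHomEquiv Y k) = toUnit X ≫ k := by
  ext n x
  exact (NatTrans.naturality_apply k _ _).symm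

lemma sliceVertexMap_unitHomEquiv (k : 𝟙_ SSet.{v} ⟶ sliceHom p q) :
    sliceVertexMap (SSet.unitHomEquiv _ k) =
      lift (𝟙 E) (toUnit E) ≫ E ◁ k ≫ sliceEval p q := by
  rw [sliceVertexMap, const_unitHomEquiv, lift_whiskerLeft_assoc]

lemma sliceVertexMap_sliceVertex (w : E ⟶ F) (hw : w ≫ q = p) :
    sliceVertexMap (sliceVertex w hw) = w := by
  rw [sliceVertex, sliceVertexMap_unitHomEquiv, sliceLift_eval, lift_fst_assoc, Category.id_comp]

lemma sliceLift_app_eq_sliceVertex (G : E ⊗ V ⟶ F) (hG : G ≫ q = fst E V ≫ p) (x : V _⦋0⦌)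
    (w : E ⟶ F) (hw : w ≫ q = p) (hx : lift (𝟙 E) (const x) ≫ G = w) :
    (sliceLift G hG).app _ x = sliceVertex w hw := by
  apply (SSet.unitHomEquiv _).symm.injective
  rw [sliceVertex, Equiv.symm_apply_apply]
  have h : (SSet.unitHomEquiv _).symm ((sliceLift G hG).app _ x) =
      const x ≫ sliceLift G hG := by
    apply (SSet.unitHomEquiv _).injective
    rw [Equiv.apply_symm_apply]
    change _ = (sliceLift G hG).app _ (V.map _ x)
    rw [Subsingleton.elim ((Opposite.unop (.op ⦋0⦌)).const ⦋0⦌ 0) (𝟙 _), op_id, V.map_id]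
    rfl
  rw [h]
  apply slice_hom_ext
  rw [sliceLift_eval, MonoidalCategory.whiskerLeft_comp_assoc, sliceLift_eval, ← hx]
  rfl

lemma const_comp_yonedaEquiv_symm_zero {X Q : SSet.{v}} (e : Q _⦋1⦌) :
    const (X := X) (stdSimplex.obj₀Equiv.symm 0) ≫ yonedaEquiv.symm e = const (Q.δ 1 e) := by
  rw [← comp_const (const (stdSimplex.obj₀Equiv.symm 0) : X ⟶ Δ[0]), ← δ_one_eq_const,
    Category.assoc, δ_comp_yonedaEquiv_symm, yonedaEquiv_symm_zero, comp_const]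

lemma const_comp_yonedaEquiv_symm_one {X Q : SSet.{v}} (e : Q _⦋1⦌) :
    const (X := X) (stdSimplex.obj₀Equiv.symm 1) ≫ yonedaEquiv.symm e = const (Q.δ 0 e) := by
  rw [← comp_const (const (stdSimplex.obj₀Equiv.symm 0) : X ⟶ Δ[0]), ← δ_zero_eq_const,
    Category.assoc, δ_comp_yonedaEquiv_symm, yonedaEquiv_symm_zero, comp_const]

/-- A map from `coherentIso` to the hom-space carries an edge, its inverse and both witnessing
2-simplices, so no horn filling in the hom-space is needed. -/
lemma sliceHomObj_iso_of_coherentIso (G : E ⊗ coherentIso.{v} ⟶ F)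
    (hG : G ≫ q = fst _ _ ≫ p) {w w' : E ⟶ F} (hw : w ≫ q = p) (hw' : w' ≫ q = p)
    (h₀ : lift (𝟙 E) (const coherentIso.x₀) ≫ G = w)
    (h₁ : lift (𝟙 E) (const coherentIso.x₁) ≫ G = w') :
    Nonempty (sliceHomObj w hw ≅ sliceHomObj w' hw') := by
  rw [sliceHomObj_eq, sliceHomObj_eq, ← sliceLift_app_eq_sliceVertex G hG _ _ hw h₀,
    ← sliceLift_app_eq_sliceVertex G hG _ _ hw' h₁]
  let I := coherentIso.invStructHom.{v}.map (sliceLift G hG)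
  exact ⟨⟨Truncated.HomotopyCategory.homMk (coherentIso.hom.map (sliceLift G hG)).toTruncated,
    Truncated.HomotopyCategory.homMk I.inv.toTruncated,
    (Truncated.HomotopyCategory.homMk_comp_homMk I.homInvId).trans
      (Truncated.HomotopyCategory.homMk_id _),
    (Truncated.HomotopyCategory.homMk_comp_homMk I.invHomId).trans
      (Truncated.HomotopyCategory.homMk_id _)⟩⟩

/-- A relation between maps over the base which contains the homotopies over the base
contains the morphisms of the homotopy category of the hom-space of the slice. -/
lemma rel_of_sliceHomObj_hom (R : (E ⟶ F) → (E ⟶ F) → Prop)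
    (refl : ∀ w, R w w) (trans : ∀ {w w' w''}, R w w' → R w' w'' → R w w'')
    (hR : ∀ G : E ⊗ Δ[1] ⟶ F, G ≫ q = fst _ _ ≫ p → R (ι₀ ≫ G) (ι₁ ≫ G))
    {w w' : E ⟶ F} {hw : w ≫ q = p} {hw' : w' ≫ q = p}
    (φ : sliceHomObj w hw ⟶ sliceHomObj w' hw') : R w w' := by
  -- The hom-space is not assumed to be a quasi-category, so a morphism is only a composite of
  -- edges; a multiplicative property containing the edges is everything.
  let W : MorphismProperty ((truncation 2).obj (sliceHom p q)).HomotopyCategory := fun x y _ ↦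
    R (sliceVertexMap (show (sliceHom p q) _⦋0⦌ from x.as.as))
      (sliceVertexMap (show (sliceHom p q) _⦋0⦌ from y.as.as))
  have : W.IsMultiplicative :=
    { id_mem x := refl _
      comp_mem _ _ h h' := trans h h' }
  have hW : W = ⊤ := Truncated.HomotopyCategory.morphismProperty_eq_top (by
    intro x y e
    have h := hR (E ◁ yonedaEquiv.symm (show (sliceHom p q) _⦋1⦌ from e.edge) ≫ sliceEval p q)
      (by rw [Category.assoc, sliceEval_comp, whiskerLeft_fst_assoc])
    have h₀ := (const_comp_yonedaEquiv_symm_zero (X := E)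
      (show (sliceHom p q) _⦋1⦌ from e.edge)).trans (congrArg const e.src_eq)
    have h₁ := (const_comp_yonedaEquiv_symm_one (X := E)
      (show (sliceHom p q) _⦋1⦌ from e.edge)).trans (congrArg const e.tgt_eq)
    change R (lift (𝟙 E) (const (show (sliceHom p q) _⦋0⦌ from x)) ≫ _)
      (lift (𝟙 E) (const (show (sliceHom p q) _⦋0⦌ from y)) ≫ _)
    rw [← h₀, ← h₁, ← lift_whiskerLeft_assoc, ← lift_whiskerLeft_assoc]
    exact h)
  have := hW.symm.le φ trivial
  change R (sliceVertexMap (sliceVertex w hw)) (sliceVertexMap (sliceVertex w' hw')) at this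
  rwa [sliceVertexMap_sliceVertex, sliceVertexMap_sliceVertex] at this

end SliceHom

/-! ### Fibred equivalences of comma objects in terms of 2-cells -/

section FibredEquivalence

variable {A B C X : SSet.{v}} {f : B ⟶ A} {g : C ⟶ A} [Quasicategory A]

/-- Maps over the base into a comma object are isomorphic over the base if and only if they
represent the same `2`-cell. -/
lemma nonempty_sliceHomObj_iso_iff {p : X ⟶ C ⊗ B} {w w' : X ⟶ comma f g}
    (hw : w ≫ commaProj f g = p) (hw' : w' ≫ commaProj f g = p) :
    Nonempty (sliceHomObj w hw ≅ sliceHomObj w' hw') ↔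
      HEquiv (w ▷ Δ[1] ≫ commaHtpy f g) (w' ▷ Δ[1] ≫ commaHtpy f g) := by
  constructor
  · rintro ⟨φ⟩
    exact rel_of_sliceHomObj_hom
      (fun w w' ↦ HEquiv (w ▷ Δ[1] ≫ commaHtpy f g) (w' ▷ Δ[1] ≫ commaHtpy f g))
      (fun _ ↦ .refl _) .trans (fun G hG ↦ hEquiv_of_homotopy_over G p hG) φ.hom
  · intro h
    obtain ⟨G, hG, h₀, h₁⟩ := exists_coherentIso_over (hw.trans hw'.symm) h
    exact sliceHomObj_iso_of_coherentIso G (by rw [hG, hw]) hw hw' h₀ h₁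

lemma isFibredEquivalence_commaProj_iff {A' : SSet.{v}} [Quasicategory A'] {f' : B ⟶ A'}
    {g' : C ⟶ A'} (w : comma f g ⟶ comma f' g') :
    IsFibredEquivalence (commaProj f g) (commaProj f' g') w ↔
      w ≫ commaProj f' g' = commaProj f g ∧ ∃ w' : comma f' g' ⟶ comma f g,
        w' ≫ commaProj f g = commaProj f' g' ∧
        HEquiv ((w ≫ w') ▷ Δ[1] ≫ commaHtpy f g) (commaHtpy f g) ∧
        HEquiv ((w' ≫ w) ▷ Δ[1] ≫ commaHtpy f' g') (commaHtpy f' g') := by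
  simp only [IsFibredEquivalence, nonempty_sliceHomObj_iso_iff, id_whiskerRight, Category.id_comp,
    exists_prop]

end FibredEquivalence

/-! ### The `2`-cells of the bicategory of quasi-categories -/

section TwoCells

/-- The vertex of the internal hom given by a map. -/
def homVertex {X Y : SSet.{v}} (f : X ⟶ Y) : ((ihom X).obj Y) _⦋0⦌ :=
  SSet.unitHomEquiv _ (MonoidalClosed.curry' f)

/-- The edge of the internal hom given by a homotopy. -/
def homEdge {X Y : SSet.{v}} (H : X ⊗ Δ[1] ⟶ Y) : ((ihom X).obj Y) _⦋1⦌ :=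
  yonedaEquiv (MonoidalClosed.curry H)

lemma homVertex_eq {X Y : SSet.{v}} (f : X ⟶ Y) :
    homVertex f = yonedaEquiv (MonoidalClosed.curry (fst X Δ[0] ≫ f)) :=
  rfl

lemma homVertex_injective {X Y : SSet.{v}} {f g : X ⟶ Y} (h : homVertex f = homVertex g) :
    f = g := by
  rw [homVertex_eq, homVertex_eq] at h
  have := MonoidalClosed.curry_injective (yonedaEquiv.injective h)
  rwa [cancel_epi] at this

lemma δ_one_homEdge {X Y : SSet.{v}} (H : X ⊗ Δ[1] ⟶ Y) :
    ((ihom X).obj Y).δ 1 (homEdge H) = homVertex (ι₀ ≫ H) := by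
  apply yonedaEquiv.symm.injective
  rw [← δ_comp_yonedaEquiv_symm, homEdge, Equiv.symm_apply_apply, homVertex_eq,
    Equiv.symm_apply_apply, ← MonoidalClosed.curry_natural_left, whiskerLeft_δ_one, Category.assoc]

lemma δ_zero_homEdge {X Y : SSet.{v}} (H : X ⊗ Δ[1] ⟶ Y) :
    ((ihom X).obj Y).δ 0 (homEdge H) = homVertex (ι₁ ≫ H) := by
  apply yonedaEquiv.symm.injective
  rw [← δ_comp_yonedaEquiv_symm, homEdge, Equiv.symm_apply_apply, homVertex_eq,
    Equiv.symm_apply_apply, ← MonoidalClosed.curry_natural_left, whiskerLeft_δ_zero, Category.assoc]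

/-- The edge of the truncated internal hom given by a homotopy. -/
def htpyEdge {X Y : SSet.{v}} {f g : X ⟶ Y} (H : X ⊗ Δ[1] ⟶ Y) (h₀ : ι₀ ≫ H = f)
    (h₁ : ι₁ ≫ H = g) :
    Truncated.Edge (X := (truncation 2).obj ((ihom X).obj Y)) (homVertex f) (homVertex g) where
  edge := homEdge H
  src_eq := (δ_one_homEdge H).trans (congrArg homVertex h₀)
  tgt_eq := (δ_zero_homEdge H).trans (congrArg homVertex h₁)

lemma exists_htpyEdge {X Y : SSet.{v}} {f g : X ⟶ Y}
    (e : Truncated.Edge (X := (truncation 2).obj ((ihom X).obj Y)) (homVertex f) (homVertex g)) :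
    ∃ (H : X ⊗ Δ[1] ⟶ Y) (h₀ : ι₀ ≫ H = f) (h₁ : ι₁ ≫ H = g), htpyEdge H h₀ h₁ = e := by
  obtain ⟨k, hk⟩ := (yonedaEquiv (X := (ihom X).obj Y) (n := ⦋1⦌)).surjective e.edge
  let H := MonoidalClosed.uncurry k
  have hH : homEdge H = e.edge := by
    rw [← hk]
    exact congrArg yonedaEquiv (MonoidalClosed.curry_uncurry k)
  refine ⟨H, homVertex_injective ?_, homVertex_injective ?_, Truncated.Edge.ext hH⟩
  · rw [← δ_one_homEdge, hH]; exact e.src_eq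
  · rw [← δ_zero_homEdge, hH]; exact e.tgt_eq

variable {X Y Z : QCat.{v}} {f g h : X ⟶ Y}

instance : Quasicategory X.obj := X.property

/-- The `2`-cells of the bicategory of quasi-categories. -/
abbrev TwoCell (f g : X ⟶ Y) : Type v := (Bicategory.homCategory X Y).Hom f g

/-- The `2`-cell of quasi-categories represented by a homotopy. -/
def cell (H : X.obj ⊗ Δ[1] ⟶ Y.obj) (h₀ : ι₀ ≫ H = f.hom) (h₁ : ι₁ ≫ H = g.hom) : TwoCell f g :=
  CatEnrichedOrdinary.Hom.mk (C := QCat.{v}) (X := X) (Y := Y)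
    (Truncated.HomotopyCategory.homMk (htpyEdge H h₀ h₁))

lemma exists_cell (α : TwoCell f g) : ∃ (H : X.obj ⊗ Δ[1] ⟶ Y.obj) (h₀ : ι₀ ≫ H = f.hom)
    (h₁ : ι₁ ≫ H = g.hom), cell H h₀ h₁ = α := by
  obtain ⟨e, he⟩ := Truncated.homMk_surjective
    (V := (truncation 2).obj ((ihom X.obj).obj Y.obj)) (x := homVertex f.hom) (y := homVertex g.hom)
    (CatEnrichedOrdinary.Hom.base (C := QCat.{v}) α)
  obtain ⟨H, h₀, h₁, rfl⟩ := exists_htpyEdge e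
  exact ⟨H, h₀, h₁, CatEnrichedOrdinary.Hom.ext _ _ he⟩

/-- Holds because `Y^X` is a quasi-category: equations between 2-cells are detected by single
2-simplices. -/
lemma cell_comp_cell_iff {H K L : X.obj ⊗ Δ[1] ⟶ Y.obj} (h₀ : ι₀ ≫ H = f.hom)
    (h₁ : ι₁ ≫ H = g.hom) (k₀ : ι₀ ≫ K = g.hom) (k₁ : ι₁ ≫ K = h.hom) (l₀ : ι₀ ≫ L = f.hom)
    (l₁ : ι₁ ≫ L = h.hom) :
    (Bicategory.homCategory X Y).comp (cell H h₀ h₁) (cell K k₀ k₁) = cell L l₀ l₁ ↔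
      IsHComp H K L := by
  have e : (Bicategory.homCategory X Y).comp (cell H h₀ h₁) (cell K k₀ k₁) = cell L l₀ l₁ ↔
      Truncated.HomotopyCategory.homMk (htpyEdge H h₀ h₁) ≫
        Truncated.HomotopyCategory.homMk (htpyEdge K k₀ k₁) =
        Truncated.HomotopyCategory.homMk (htpyEdge L l₀ l₁) :=
    ⟨fun h ↦ congrArg (CatEnrichedOrdinary.Hom.base (C := QCat.{v})) h,
      fun h ↦ CatEnrichedOrdinary.Hom.ext _ _ h⟩
  rw [isHComp_iff_isComp_curry]
  refine e.trans ((Truncated.homMk_comp_homMk_iff (htpyEdge H h₀ h₁) (htpyEdge K k₀ k₁)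
    (htpyEdge L l₀ l₁)).trans ((nonempty_compStruct_iff_isComp
      (Q := (ihom X.obj).obj Y.obj) (htpyEdge H h₀ h₁) (htpyEdge K k₀ k₁)
      (htpyEdge L l₀ l₁)).trans ?_))
  change IsComp (yonedaEquiv.symm (yonedaEquiv _)) (yonedaEquiv.symm (yonedaEquiv _))
    (yonedaEquiv.symm (yonedaEquiv _)) ↔ _
  simp only [Equiv.symm_apply_apply]

lemma cell_constH : cell (constH f.hom) rfl rfl = (Bicategory.homCategory X Y).id f :=
  CatEnrichedOrdinary.Hom.ext _ _ (Truncated.HomotopyCategory.homMk_id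
    (V := (truncation 2).obj ((ihom X.obj).obj Y.obj)) (homVertex f.hom))

lemma whiskerRight_cell {H : X.obj ⊗ Δ[1] ⟶ Y.obj} (h₀ : ι₀ ≫ H = f.hom)
    (h₁ : ι₁ ≫ H = g.hom) (k : Y ⟶ Z) :
    Bicategory.whiskerRight (cell H h₀ h₁) k = cell (f := f ≫ k) (g := g ≫ k) (H ≫ k.hom)
      (congrArg (· ≫ k.hom) h₀) (congrArg (· ≫ k.hom) h₁) := by
  refine CatEnrichedOrdinary.Hom.ext _ _ ?_
  refine (Category.id_comp _).trans ((Category.comp_id _).trans ?_)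
  rfl

lemma whiskerLeft_cell (s : Z ⟶ X) {H : X.obj ⊗ Δ[1] ⟶ Y.obj} (h₀ : ι₀ ≫ H = f.hom)
    (h₁ : ι₁ ≫ H = g.hom) :
    Bicategory.whiskerLeft s (cell H h₀ h₁) = cell (f := s ≫ f) (g := s ≫ g) (s.hom ▷ Δ[1] ≫ H)
      (congrArg (s.hom ≫ ·) h₀) (congrArg (s.hom ≫ ·) h₁) := by
  refine CatEnrichedOrdinary.Hom.ext _ _ ?_
  refine (Category.id_comp _).trans ((Category.comp_id _).trans ?_)
  rfl

end TwoCells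

/-! ### Adjunctions in terms of homotopies -/

section Adjunction

variable {A B : QCat.{v}} {f : B ⟶ A} {u : A ⟶ B}

lemma leftZigzag_cell_iff {η : B.obj ⊗ Δ[1] ⟶ B.obj} {ε : A.obj ⊗ Δ[1] ⟶ A.obj}
    (η₀ : ι₀ ≫ η = 𝟙 B.obj) (η₁ : ι₁ ≫ η = f.hom ≫ u.hom) (ε₀ : ι₀ ≫ ε = u.hom ≫ f.hom)
    (ε₁ : ι₁ ≫ ε = 𝟙 A.obj) :
    Bicategory.leftZigzag (f := f) (g := u) (cell (f := 𝟙 B) (g := f ≫ u) η η₀ η₁)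
      (cell (f := u ≫ f) (g := 𝟙 A) ε ε₀ ε₁) =
        (Bicategory.leftUnitor f).hom ≫ (Bicategory.rightUnitor f).inv ↔
      IsHComp (η ≫ f.hom) (f.hom ▷ Δ[1] ≫ ε) (constH f.hom) := by
  let hη := cell (f := 𝟙 B) (g := f ≫ u) η η₀ η₁
  let hε := cell (f := u ≫ f) (g := 𝟙 A) ε ε₀ ε₁
  -- The coherence 2-cells in the zigzag are identities.
  have e : Bicategory.leftZigzag (f := f) (g := u) hη hε =
      Bicategory.whiskerRight hη f ≫ Bicategory.whiskerLeft f hε :=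
    congrArg (Bicategory.whiskerRight hη f ≫ ·)
      ((Category.assoc _ _ _).trans ((Category.id_comp _).trans (Category.id_comp _)))
  have e₁ := whiskerRight_cell (f := 𝟙 B) (g := f ≫ u) η₀ η₁ f
  have e₂ := whiskerLeft_cell (f := u ≫ f) (g := 𝟙 A) f ε₀ ε₁
  have e₃ : (Bicategory.leftUnitor f).hom ≫ (Bicategory.rightUnitor f).inv =
      cell (f := f) (g := f) (constH f.hom) rfl rfl :=
    (Category.id_comp _).trans cell_constH.symm
  have e₄ := e.trans (congrArg₂ (Bicategory.homCategory B A).comp e₁ e₂)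
  exact Iff.trans ⟨fun h ↦ e₄.symm.trans (h.trans e₃), fun h ↦ e₄.trans (h.trans e₃.symm)⟩
    (cell_comp_cell_iff (f := f) (g := f ≫ u ≫ f) (h := f) _ _ _ _ _ _)

lemma rightZigzag_cell_iff {η : B.obj ⊗ Δ[1] ⟶ B.obj} {ε : A.obj ⊗ Δ[1] ⟶ A.obj}
    (η₀ : ι₀ ≫ η = 𝟙 B.obj) (η₁ : ι₁ ≫ η = f.hom ≫ u.hom) (ε₀ : ι₀ ≫ ε = u.hom ≫ f.hom)
    (ε₁ : ι₁ ≫ ε = 𝟙 A.obj) :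
    Bicategory.rightZigzag (f := f) (g := u) (cell (f := 𝟙 B) (g := f ≫ u) η η₀ η₁)
      (cell (f := u ≫ f) (g := 𝟙 A) ε ε₀ ε₁) =
        (Bicategory.rightUnitor u).hom ≫ (Bicategory.leftUnitor u).inv ↔
      IsHComp (u.hom ▷ Δ[1] ≫ η) (ε ≫ u.hom) (constH u.hom) := by
  let hη := cell (f := 𝟙 B) (g := f ≫ u) η η₀ η₁
  let hε := cell (f := u ≫ f) (g := 𝟙 A) ε ε₀ ε₁
  have e : Bicategory.rightZigzag (f := f) (g := u) hη hε =
      Bicategory.whiskerLeft u hη ≫ Bicategory.whiskerRight hε u :=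
    congrArg (Bicategory.whiskerLeft u hη ≫ ·)
      ((Category.assoc _ _ _).trans ((Category.id_comp _).trans (Category.id_comp _)))
  have e₁ := whiskerLeft_cell (f := 𝟙 B) (g := f ≫ u) u η₀ η₁
  have e₂ := whiskerRight_cell (f := u ≫ f) (g := 𝟙 A) ε₀ ε₁ u
  have e₃ : (Bicategory.rightUnitor u).hom ≫ (Bicategory.leftUnitor u).inv =
      cell (f := u) (g := u) (constH u.hom) rfl rfl :=
    (Category.id_comp _).trans cell_constH.symm
  have e₄ := e.trans (congrArg₂ (Bicategory.homCategory A B).comp e₁ e₂)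
  exact Iff.trans ⟨fun h ↦ e₄.symm.trans (h.trans e₃), fun h ↦ e₄.trans (h.trans e₃.symm)⟩
    (cell_comp_cell_iff (f := u) (g := u ≫ f ≫ u) (h := u) _ _ _ _ _ _)

lemma nonempty_adjunction_iff (f : B ⟶ A) (u : A ⟶ B) :
    Nonempty (Bicategory.Adjunction f u) ↔
      ∃ (η : B.obj ⊗ Δ[1] ⟶ B.obj) (ε : A.obj ⊗ Δ[1] ⟶ A.obj),
        (ι₀ ≫ η = 𝟙 B.obj ∧ ι₁ ≫ η = f.hom ≫ u.hom) ∧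
        (ι₀ ≫ ε = u.hom ≫ f.hom ∧ ι₁ ≫ ε = 𝟙 A.obj) ∧
        IsHComp (η ≫ f.hom) (f.hom ▷ Δ[1] ≫ ε) (constH f.hom) ∧
        IsHComp (u.hom ▷ Δ[1] ≫ η) (ε ≫ u.hom) (constH u.hom) := by
  constructor
  · rintro ⟨⟨unit, counit, hl, hr⟩⟩
    obtain ⟨η, η₀, η₁, rfl⟩ := exists_cell (f := 𝟙 B) (g := f ≫ u) unit
    obtain ⟨ε, ε₀, ε₁, rfl⟩ := exists_cell (f := u ≫ f) (g := 𝟙 A) counit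
    exact ⟨η, ε, ⟨η₀, η₁⟩, ⟨ε₀, ε₁⟩, (leftZigzag_cell_iff η₀ η₁ ε₀ ε₁).1 hl,
      (rightZigzag_cell_iff η₀ η₁ ε₀ ε₁).1 hr⟩
  · rintro ⟨η, ε, ⟨η₀, η₁⟩, ⟨ε₀, ε₁⟩, hl, hr⟩
    exact ⟨⟨cell (f := 𝟙 B) (g := f ≫ u) η η₀ η₁, cell (f := u ≫ f) (g := 𝟙 A) ε ε₀ ε₁,
      (leftZigzag_cell_iff η₀ η₁ ε₀ ε₁).2 hl, (rightZigzag_cell_iff η₀ η₁ ε₀ ε₁).2 hr⟩⟩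

end Adjunction

/-! ### From an adjunction to an equivalence of comma objects -/

section OfAdjunction

variable {A B : SSet.{v}} [Quasicategory A] [Quasicategory B] {f : B ⟶ A} {u : A ⟶ B}
  {η : B ⊗ Δ[1] ⟶ B} {ε : A ⊗ Δ[1] ⟶ A}

lemma exists_fibredEquivalence_of_adjunction (η₀ : ι₀ ≫ η = 𝟙 B) (η₁ : ι₁ ≫ η = f ≫ u)
    (ε₀ : ι₀ ≫ ε = u ≫ f) (ε₁ : ι₁ ≫ ε = 𝟙 A)
    (hl : IsHComp (η ≫ f) (f ▷ Δ[1] ≫ ε) (constH f))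
    (hr : IsHComp (u ▷ Δ[1] ≫ η) (ε ≫ u) (constH u)) :
    ∃ w : comma f (𝟙 A) ⟶ comma (𝟙 B) u,
      IsFibredEquivalence (commaProj f (𝟙 A)) (commaProj (𝟙 B) u) w := by
  simp only [isFibredEquivalence_commaProj_iff]
  set φ := commaHtpy f (𝟙 A) with hφ
  set ψ := commaHtpy (𝟙 B) u with hψ
  let p₁ : comma f (𝟙 A) ⟶ A := commaProj f (𝟙 A) ≫ fst A B
  let p₀ : comma f (𝟙 A) ⟶ B := commaProj f (𝟙 A) ≫ snd A B
  let q₁ : comma (𝟙 B) u ⟶ A := commaProj (𝟙 B) u ≫ fst A B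
  let q₀ : comma (𝟙 B) u ⟶ B := commaProj (𝟙 B) u ≫ snd A B
  have φ₀ : ι₀ ≫ φ = p₀ ≫ f := by rw [hφ, ι₀_commaHtpy, Category.assoc]
  have φ₁ : ι₁ ≫ φ = p₁ := by rw [hφ, ι₁_commaHtpy, Category.comp_id]
  have ψ₀ : ι₀ ≫ ψ = q₀ := by rw [hψ, ι₀_commaHtpy, Category.comp_id]
  have ψ₁ : ι₁ ≫ ψ = q₁ ≫ u := by rw [hψ, ι₁_commaHtpy, Category.assoc]
  -- `W` is the transpose `uφ ∘ η`, and `W'` below is `ε ∘ fψ`.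
  obtain ⟨W, hW⟩ := exists_isHComp (p₀ ▷ Δ[1] ≫ η) (φ ≫ u) (by
    rw [ι₁_comp_assoc, η₁, reassoc_of% φ₀])
  obtain ⟨W', hW'⟩ := exists_isHComp (ψ ≫ f) (q₁ ▷ Δ[1] ≫ ε) (by
    rw [ι₀_comp_assoc, ε₀, reassoc_of% ψ₁])
  let w : comma f (𝟙 A) ⟶ comma (𝟙 B) u := commaLift p₁ p₀ W
    (by rw [hW.src_eq, ι₀_comp_assoc, η₀]) (by rw [hW.tgt_eq, reassoc_of% φ₁])
  let w' : comma (𝟙 B) u ⟶ comma f (𝟙 A) := commaLift q₁ q₀ W'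
    (by rw [hW'.src_eq, reassoc_of% ψ₀]) (by rw [hW'.tgt_eq, ι₁_comp_assoc, ε₁])
  have wp : w ≫ commaProj (𝟙 B) u = commaProj f (𝟙 A) := by
    rw [commaLift_proj, ← comp_lift, lift_fst_snd, Category.comp_id]
  have wp' : w' ≫ commaProj f (𝟙 A) = commaProj (𝟙 B) u := by
    rw [commaLift_proj, ← comp_lift, lift_fst_snd, Category.comp_id]
  have wψ : w ▷ Δ[1] ≫ ψ = W := commaLift_htpy ..
  have wφ : w' ▷ Δ[1] ≫ φ = W' := commaLift_htpy ..
  refine ⟨w, wp, w', wp', HEquiv.symm ?_, HEquiv.symm ?_⟩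
  -- The square is naturality of ε along φ: `ε ∘ fuφ ∘ fη = φ ∘ εf ∘ fη`, which is φ by the first
  -- triangle identity.
  · obtain ⟨D, h, h'⟩ := exists_isHComp_square (φ ▷ Δ[1] ≫ ε)
    rw [ι₀_comp_assoc, ε₀, ← comp_whiskerRight_assoc, φ₁] at h
    rw [ι₁_comp_assoc, ε₁, ← comp_whiskerRight_assoc, φ₀, Category.comp_id] at h'
    have hx := hW'.precomp w
    rw [reassoc_of% wψ, ← comp_whiskerRight_assoc, ← Category.assoc w, wp] at hx
    have hl' := hl.precomp p₀
    rw [← comp_whiskerRight_assoc] at hl'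
    have hW₁ := hW.postcomp f
    rw [HEquiv.iff_left, comp_whiskerRight_assoc, wφ, φ₀]
    rw [Category.assoc, Category.assoc] at hW₁
    exact hl'.fill₁ h' (hW₁.fill₂ h hx)
  -- Dually, by naturality of η along ψ and the second triangle identity.
  · obtain ⟨D, h, h'⟩ := exists_isHComp_square (ψ ▷ Δ[1] ≫ η)
    rw [ι₀_comp_assoc, η₀, ← comp_whiskerRight_assoc, ψ₁, Category.comp_id] at h
    rw [ι₁_comp_assoc, η₁, ← comp_whiskerRight_assoc, ψ₀] at h'
    have hx := hW.precomp w'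
    rw [reassoc_of% wφ, ← comp_whiskerRight_assoc, ← Category.assoc w', wp'] at hx
    have hr' := hr.precomp q₁
    rw [← comp_whiskerRight_assoc] at hr'
    have hW₁ := hW'.postcomp u
    rw [HEquiv, comp_whiskerRight_assoc, wψ, ψ₁]
    rw [Category.assoc, Category.assoc] at hW₁
    exact h.fill₂ hr' (h'.fill₁ hW₁ hx)

end OfAdjunction

/-! ### From an equivalence of comma objects to an adjunction -/

section CommaMap

/-- The minimum `Δ[1] × Δ[1] ⟶ Δ[1]`. -/
def meet : Δ[1] ⊗ Δ[1] ⟶ (Δ[1] : SSet.{v}) where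
  app n := ↾fun x ↦ stdSimplex.objMk
    ((stdSimplex.objEquiv x.1).toOrderHom ⊓ (stdSimplex.objEquiv x.2).toOrderHom)

/-- The maximum `Δ[1] × Δ[1] ⟶ Δ[1]`. -/
def join : Δ[1] ⊗ Δ[1] ⟶ (Δ[1] : SSet.{v}) where
  app n := ↾fun x ↦ stdSimplex.objMk
    ((stdSimplex.objEquiv x.1).toOrderHom ⊔ (stdSimplex.objEquiv x.2).toOrderHom)

variable {X : SSet.{v}}

variable (X) in
/-- The homotopy from a constant homotopy to the generic one. -/
def meetHtpy : (X ⊗ Δ[1]) ⊗ Δ[1] ⟶ X ⊗ Δ[1] := (α_ X Δ[1] Δ[1]).hom ≫ X ◁ meet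

variable (X) in
/-- The homotopy from the generic homotopy to a constant one. -/
def joinHtpy : (X ⊗ Δ[1]) ⊗ Δ[1] ⟶ X ⊗ Δ[1] := (α_ X Δ[1] Δ[1]).hom ≫ X ◁ join

lemma ι₀_meetHtpy : ι₀ ≫ meetHtpy X = fst _ _ ≫ ι₀ := by
  have h : ι₀ ≫ meet.{v} = const (stdSimplex.obj₀Equiv.symm 0) := by decide
  exact congrArg (X ◁ ·) h

lemma ι₁_meetHtpy : ι₁ ≫ meetHtpy X = 𝟙 _ := by
  have h : ι₁ ≫ meet.{v} = 𝟙 _ := by decide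
  exact congrArg (X ◁ ·) h

lemma ι₀_whiskerRight_meetHtpy : ι₀ ▷ Δ[1] ≫ meetHtpy X = fst _ _ ≫ ι₀ := by
  have h : lift (const (stdSimplex.obj₀Equiv.symm 0)) (𝟙 _) ≫ meet.{v} =
    const (stdSimplex.obj₀Equiv.symm 0) := by decide
  exact congrArg (X ◁ ·) h

lemma ι₁_whiskerRight_meetHtpy : ι₁ ▷ Δ[1] ≫ meetHtpy X = 𝟙 _ := by
  have h : lift (const (stdSimplex.obj₀Equiv.symm 1)) (𝟙 _) ≫ meet.{v} = 𝟙 _ := by decide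
  exact congrArg (X ◁ ·) h

lemma ι₀_joinHtpy : ι₀ ≫ joinHtpy X = 𝟙 _ := by
  have h : ι₀ ≫ join.{v} = 𝟙 _ := by decide
  exact congrArg (X ◁ ·) h

lemma ι₁_joinHtpy : ι₁ ≫ joinHtpy X = fst _ _ ≫ ι₁ := by
  have h : ι₁ ≫ join.{v} = const (stdSimplex.obj₀Equiv.symm 1) := by decide
  exact congrArg (X ◁ ·) h

lemma ι₀_whiskerRight_joinHtpy : ι₀ ▷ Δ[1] ≫ joinHtpy X = 𝟙 _ := by
  have h : lift (const (stdSimplex.obj₀Equiv.symm 0)) (𝟙 _) ≫ join.{v} = 𝟙 _ := by decide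
  exact congrArg (X ◁ ·) h

lemma ι₁_whiskerRight_joinHtpy : ι₁ ▷ Δ[1] ≫ joinHtpy X = fst _ _ ≫ ι₁ := by
  have h : lift (const (stdSimplex.obj₀Equiv.symm 1)) (𝟙 _) ≫ join.{v} =
    const (stdSimplex.obj₀Equiv.symm 1) := by decide
  exact congrArg (X ◁ ·) h

variable {A A' B C : SSet.{v}} {f : B ⟶ A} {g : C ⟶ A} {f' : B ⟶ A'} {g' : C ⟶ A'}
  [Quasicategory A'] {w : comma f g ⟶ comma f' g'}

/-- A map of comma objects over the base is natural in the codomain: it carries the composite of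
an identity with a homotopy `γ` to the composite of the image of the identity with `γ`. -/
lemma isHComp_commaMap_codomain (hw : w ≫ commaProj f' g' = commaProj f g) {s s' : X ⟶ comma f g}
    (γ : X ⊗ Δ[1] ⟶ C) (b : X ⟶ B) (hs : s ≫ commaProj f g = lift (ι₀ ≫ γ) b)
    (hs' : s' ≫ commaProj f g = lift (ι₁ ≫ γ) b)
    (h : s ▷ Δ[1] ≫ commaHtpy f g = constH (b ≫ f))
    (h' : s' ▷ Δ[1] ≫ commaHtpy f g = γ ≫ g) :
    IsHComp ((s ≫ w) ▷ Δ[1] ≫ commaHtpy f' g') (γ ≫ g')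
      ((s' ≫ w) ▷ Δ[1] ≫ commaHtpy f' g') := by
  have e : ι₀ ≫ γ ≫ g = b ≫ f := by
    have := congrArg (ι₀ ≫ ·) h'
    rw [ι₀_comp_assoc, ι₀_commaHtpy, reassoc_of% hs', lift_snd_assoc] at this
    exact this.symm
  -- At time t this path in the comma object carries `γ ≫ g` restricted to `[0, t]`, so it runs from
  -- the identity `s` to `s'`.
  let G : X ⊗ Δ[1] ⟶ comma f g := commaLift γ (fst _ _ ≫ b) (meetHtpy X ≫ γ ≫ g)
    (by rw [reassoc_of% (ι₀_meetHtpy (X := X)), e, Category.assoc])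
    (by rw [reassoc_of% (ι₁_meetHtpy (X := X))])
  have hG : G ≫ commaProj f g = lift γ (fst _ _ ≫ b) := commaLift_proj ..
  have G₀ : ι₀ ≫ G = s := by
    apply comma_hom_ext
    · rw [Category.assoc, hG, comp_lift, hs, ι₀_fst_assoc]
    · rw [comp_whiskerRight_assoc, commaLift_htpy, h,
        reassoc_of% (ι₀_whiskerRight_meetHtpy (X := X)), e]
      rfl
  have G₁ : ι₁ ≫ G = s' := by
    apply comma_hom_ext
    · rw [Category.assoc, hG, comp_lift, hs', ι₁_fst_assoc]
    · rw [comp_whiskerRight_assoc, commaLift_htpy, h',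
        reassoc_of% (ι₁_whiskerRight_meetHtpy (X := X))]
  obtain ⟨D, hD, hD'⟩ := exists_isHComp_square ((G ≫ w) ▷ Δ[1] ≫ commaHtpy f' g')
  rw [ι₀_comp_assoc, ι₀_commaHtpy, ← comp_whiskerRight_assoc, Category.assoc, reassoc_of% hw,
    reassoc_of% hG, lift_snd_assoc, reassoc_of% G₁, Category.assoc] at hD
  rw [ι₁_comp_assoc, ι₁_commaHtpy, ← comp_whiskerRight_assoc, Category.assoc, reassoc_of% hw,
    reassoc_of% hG, lift_fst_assoc, reassoc_of% G₀] at hD'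
  refine hD'.congr_right (HEquiv.symm ?_)
  rw [HEquiv.iff_left, ι₀_comp_assoc, ι₀_commaHtpy, Category.assoc, reassoc_of% hw,
    reassoc_of% hs', lift_snd_assoc]
  exact hD

/-- A map of comma objects over the base is natural in the domain: it carries the composite of a
homotopy `β` with an identity to the composite of `β` with the image of the identity. -/
lemma isHComp_commaMap_domain (hw : w ≫ commaProj f' g' = commaProj f g) {s s' : X ⟶ comma f g}
    (β : X ⊗ Δ[1] ⟶ B) (c : X ⟶ C) (hs : s ≫ commaProj f g = lift c (ι₁ ≫ β))
    (hs' : s' ≫ commaProj f g = lift c (ι₀ ≫ β))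
    (h : s ▷ Δ[1] ≫ commaHtpy f g = constH (c ≫ g))
    (h' : s' ▷ Δ[1] ≫ commaHtpy f g = β ≫ f) :
    IsHComp (β ≫ f') ((s ≫ w) ▷ Δ[1] ≫ commaHtpy f' g')
      ((s' ≫ w) ▷ Δ[1] ≫ commaHtpy f' g') := by
  have e : ι₁ ≫ β ≫ f = c ≫ g := by
    have := congrArg (ι₁ ≫ ·) h'
    rw [ι₁_comp_assoc, ι₁_commaHtpy, reassoc_of% hs', lift_fst_assoc] at this
    exact this.symm
  -- At time t the arrow is `β ≫ f` restricted to `[t, 1]`, so the path runs from `s'` to the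
  -- identity `s`.
  let G : X ⊗ Δ[1] ⟶ comma f g := commaLift (fst _ _ ≫ c) β (joinHtpy X ≫ β ≫ f)
    (by rw [reassoc_of% (ι₀_joinHtpy (X := X))])
    (by rw [reassoc_of% (ι₁_joinHtpy (X := X)), e, Category.assoc])
  have hG : G ≫ commaProj f g = lift (fst _ _ ≫ c) β := commaLift_proj ..
  have G₀ : ι₀ ≫ G = s' := by
    apply comma_hom_ext
    · rw [Category.assoc, hG, comp_lift, hs', ι₀_fst_assoc]
    · rw [comp_whiskerRight_assoc, commaLift_htpy, h',
        reassoc_of% (ι₀_whiskerRight_joinHtpy (X := X))]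
  have G₁ : ι₁ ≫ G = s := by
    apply comma_hom_ext
    · rw [Category.assoc, hG, comp_lift, hs, ι₁_fst_assoc]
    · rw [comp_whiskerRight_assoc, commaLift_htpy, h,
        reassoc_of% (ι₁_whiskerRight_joinHtpy (X := X)), e]
      rfl
  obtain ⟨D, hD, hD'⟩ := exists_isHComp_square ((G ≫ w) ▷ Δ[1] ≫ commaHtpy f' g')
  rw [ι₀_comp_assoc, ι₀_commaHtpy, ← comp_whiskerRight_assoc, Category.assoc, reassoc_of% hw,
    reassoc_of% hG, lift_snd_assoc, reassoc_of% G₁] at hD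
  rw [ι₁_comp_assoc, ι₁_commaHtpy, ← comp_whiskerRight_assoc, Category.assoc, reassoc_of% hw,
    reassoc_of% hG, lift_fst_assoc, reassoc_of% G₀, Category.assoc] at hD'
  refine hD.congr_right (HEquiv.symm ?_)
  rw [HEquiv, ι₁_comp_assoc, ι₁_commaHtpy, Category.assoc, reassoc_of% hw,
    reassoc_of% hs', lift_fst_assoc]
  exact hD'

end CommaMap

/-! ### Unit, counit and triangle identities -/

section OfEquivalence

variable {A B : SSet.{v}} [Quasicategory A] [Quasicategory B] {f : B ⟶ A} {u : A ⟶ B}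

lemma exists_adjunction_of_fibredEquivalence {w : comma f (𝟙 A) ⟶ comma (𝟙 B) u}
    (h : IsFibredEquivalence (commaProj f (𝟙 A)) (commaProj (𝟙 B) u) w) :
    ∃ (η : B ⊗ Δ[1] ⟶ B) (ε : A ⊗ Δ[1] ⟶ A), (ι₀ ≫ η = 𝟙 B ∧ ι₁ ≫ η = f ≫ u) ∧
      (ι₀ ≫ ε = u ≫ f ∧ ι₁ ≫ ε = 𝟙 A) ∧ IsHComp (η ≫ f) (f ▷ Δ[1] ≫ ε) (constH f) ∧
      IsHComp (u ▷ Δ[1] ≫ η) (ε ≫ u) (constH u) := by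
  rw [isFibredEquivalence_commaProj_iff] at h
  obtain ⟨hw, w', hw', h, h'⟩ := h
  let s : B ⟶ comma f (𝟙 A) := commaLift f (𝟙 B) (constH f) rfl rfl
  let t : A ⟶ comma (𝟙 B) u := commaLift (𝟙 A) u (constH u) rfl rfl
  have hs : s ≫ commaProj f (𝟙 A) = lift f (𝟙 B) := commaLift_proj ..
  have ht : t ≫ commaProj (𝟙 B) u = lift (𝟙 A) u := commaLift_proj ..
  have sφ : s ▷ Δ[1] ≫ commaHtpy f (𝟙 A) = constH f := commaLift_htpy ..
  have tψ : t ▷ Δ[1] ≫ commaHtpy (𝟙 B) u = constH u := commaLift_htpy ..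
  let η := (s ≫ w) ▷ Δ[1] ≫ commaHtpy (𝟙 B) u
  let ε := (t ≫ w') ▷ Δ[1] ≫ commaHtpy f (𝟙 A)
  have η₀ : ι₀ ≫ η = 𝟙 B := by
    rw [ι₀_comp_assoc, ι₀_commaHtpy, Category.assoc, reassoc_of% hw, reassoc_of% hs,
      lift_snd_assoc, Category.id_comp]
  have η₁ : ι₁ ≫ η = f ≫ u := by
    rw [ι₁_comp_assoc, ι₁_commaHtpy, Category.assoc, reassoc_of% hw, reassoc_of% hs,
      lift_fst_assoc]
  have ε₀ : ι₀ ≫ ε = u ≫ f := by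
    rw [ι₀_comp_assoc, ι₀_commaHtpy, Category.assoc, reassoc_of% hw', reassoc_of% ht,
      lift_snd_assoc]
  have ε₁ : ι₁ ≫ ε = 𝟙 A := by
    rw [ι₁_comp_assoc, ι₁_commaHtpy, Category.assoc, reassoc_of% hw', reassoc_of% ht,
      lift_fst_assoc, Category.id_comp]
  refine ⟨η, ε, ⟨η₀, η₁⟩, ⟨ε₀, ε₁⟩, ?_, ?_⟩
  -- The homotopy η is itself the arrow classified by `s ≫ w`. Naturality of `w'` along it gives `εf
  -- ∘ fη = w'(w(id_f))`, which is the identity since `w'` inverts `w`.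
  · have := isHComp_commaMap_domain hw' (s := f ≫ t) (s' := s ≫ w) η f
      (by rw [Category.assoc, ht, comp_lift, Category.comp_id, η₁])
      (by rw [Category.assoc, hw, hs, η₀])
      (by rw [comp_whiskerRight_assoc, tψ, whiskerRight_constH]) (Category.comp_id _).symm
    rw [Category.assoc f, comp_whiskerRight_assoc f] at this
    refine this.congr_right ?_
    have h₂ := h.precomp s
    rwa [sφ, ← comp_whiskerRight_assoc, ← Category.assoc s] at h₂
  -- Dually, naturality of `w` along ε gives `uε ∘ ηu = w(w'(id_u))`.
  · have := isHComp_commaMap_codomain hw (s := u ≫ s) (s' := t ≫ w') ε u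
      (by rw [Category.assoc, hs, comp_lift, Category.comp_id, ε₀])
      (by rw [Category.assoc, hw', ht, ε₁])
      (by rw [comp_whiskerRight_assoc, sφ, whiskerRight_constH]) (Category.comp_id _).symm
    rw [Category.assoc u, comp_whiskerRight_assoc u] at this
    refine this.congr_right ?_
    have h₂ := h'.precomp t
    rwa [tψ, ← comp_whiskerRight_assoc, ← Category.assoc t] at h₂

end OfEquivalence

end SSet

end

theorem mainTheorem4 (A B : SSet.QCat) (f : B ⟶ A) (u : A ⟶ B) :
    Nonempty (Bicategory.Adjunction f u) ↔
      ∃ w : SSet.comma f.hom (𝟙 A.obj) ⟶ SSet.comma (𝟙 B.obj) u.hom,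
        SSet.IsFibredEquivalence
          (SSet.commaProj f.hom (𝟙 A.obj)) (SSet.commaProj (𝟙 B.obj) u.hom) w := by
  rw [SSet.nonempty_adjunction_iff]
  constructor
  · rintro ⟨η, ε, ⟨η₀, η₁⟩, ⟨ε₀, ε₁⟩, hl, hr⟩
    exact SSet.exists_fibredEquivalence_of_adjunction η₀ η₁ ε₀ ε₁ hl hr
  · rintro ⟨w, hw⟩
    exact SSet.exists_adjunction_of_fibredEquivalence hw
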